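/- Throughout, "smooth" means $C^\infty$. Let $S$ be a connected smooth surface immersed in $\mathbb{R}^3$, i.e. $S$ is given by a smooth immersion $f:M\to\mathbb{R}^3$ of a connected (Hausdorff) smooth 2-manifold $M$. A *planar geodesic foliation* of $S$ is a smooth 1-dimensional foliation of $M$ whose leaves are geodesics of $S$ (for the metric induced by $f$) such that each leaf is mapped by $f$ into a plane and, along that leaf, the normal to the surface is parallel to this plane. **Theorem 2.2.** Suppose that $S$ admits two planar geodesic foliations $\mathcal{F}_1,\mathcal{F}_2$ that are distinct everywhere locally, i.e. there is no nonempty open subset of $M$ on which $\mathcal{F}_1$ and $\mathcal{F}_2$ coincide (have the same tangent lines). Then at least one of the following holds: 1. $S$ is an open subset of a sphere: $f(M)$ is a relatively open subset of a round sphere of positive radius in $\mathbb{R}^3$; 2. every point of $S$ has a neighbourhood that is an open subset of a cylinder over a plane curve: every $p\in M$ has an open neighbourhood $U$ such that $f|_U$ is injective and $f(U)$ is a relatively open subset of a cylinder $\gamma\times\mathbb{R}=\{\gamma(t)+s\,e : t\in I,\ s\in\mathbb{R}\}$, where $I$ is a nonempty open interval, $\gamma:I\to\mathbb{R}^3$ is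 a smooth regular injective curve lying in a plane $P$, and $e$ is a unit normal of $P$. -/

import Mathlib

open scoped Manifold ContDiff

/-- The Euclidean plane, on which surfaces are modelled. -/
abbrev E2 : Type := EuclideanSpace ℝ (Fin 2)

/-- Euclidean three-space. -/
abbrev E3 : Type := EuclideanSpace ℝ (Fin 3)

section Surface

variable {M : Type*} [TopologicalSpace M] [ChartedSpace E2 M]

/-- `f` is a smooth immersion of the surface `M` in three-space. -/
def IsSurfaceImmersion (f : M → E3) : Prop :=
  ContMDiff (𝓡 2) 𝓘(ℝ, E3) ∞ f ∧
    ∀ p : M, Function.Injective (mfderiv (𝓡 2) 𝓘(ℝ, E3) f p)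

/-- The tangent plane at `p` of the surface immersed by `f`, as a linear subspace of
three-space. -/
noncomputable def tangentPlane (f : M → E3) (p : M) : Submodule ℝ E3 :=
  LinearMap.range (mfderiv (𝓡 2) 𝓘(ℝ, E3) f p : E2 →L[ℝ] E3).toLinearMap

/-- The normal line at `p` of the surface immersed by `f`. -/
noncomputable def normalLine (f : M → E3) (p : M) : Submodule ℝ E3 :=
  (tangentPlane f p)ᗮ

/-- A (smooth) one-dimensional foliation of the surface `M`, given by its field of tangent lines:
`L p` is the tangent line at `p` of the leaf through `p`, and `L` is locally spanned by a smooth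
nowhere vanishing vector field. (In dimension one every such field is integrable; the leaves are
the images of its maximal integral curves.) -/
def IsFoliation [IsManifold (𝓡 2) ∞ M]
    (L : (p : M) → Submodule ℝ (TangentSpace (𝓡 2) p)) : Prop :=
  ∀ p : M, ∃ U : Set M, IsOpen U ∧ p ∈ U ∧
    ∃ X : (q : M) → TangentSpace (𝓡 2) q,
      ContMDiffOn (𝓡 2) (𝓡 2).tangent ∞ (fun q => (⟨q, X q⟩ : TangentBundle (𝓡 2) M)) U ∧
      ∀ q ∈ U, X q ≠ 0 ∧ L q = Submodule.span ℝ {X q}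

/-- `c`, restricted to the open interval `I` (bounded or not), is a smooth curve in `M` that runs
in a leaf of the foliation `L` and whose image under `f` has unit speed. Every leaf, and every arc
of a leaf, is the image of such a curve. -/
def IsUnitSpeedLeafCurve (f : M → E3) (L : (p : M) → Submodule ℝ (TangentSpace (𝓡 2) p))
    (I : Set ℝ) (c : ℝ → M) : Prop :=
  IsOpen I ∧ I.OrdConnected ∧ ContMDiffOn 𝓘(ℝ, ℝ) (𝓡 2) ∞ c I ∧
    ∀ t ∈ I, mfderiv 𝓘(ℝ, ℝ) (𝓡 2) c t (1 : ℝ) ∈ L (c t) ∧ ‖deriv (f ∘ c) t‖ = 1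

/-- The foliation `L` is a planar geodesic foliation of the surface immersed by `f`: each leaf is
a geodesic (its acceleration with respect to arc length is normal to the surface), and lies in a
plane `P` such that along the leaf the surface normal is parallel to `P`. -/
structure IsPlanarGeodesicFoliation [IsManifold (𝓡 2) ∞ M] (f : M → E3)
    (L : (p : M) → Submodule ℝ (TangentSpace (𝓡 2) p)) : Prop where
  foliation : IsFoliation L
  geodesic : ∀ (I : Set ℝ) (c : ℝ → M), IsUnitSpeedLeafCurve f L I c →
    ∀ t ∈ I, deriv (deriv (f ∘ c)) t ∈ normalLine f (c t)
  planar : ∀ (I : Set ℝ) (c : ℝ → M), IsUnitSpeedLeafCurve f L I c →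
    ∃ P : AffineSubspace ℝ E3, Module.finrank ℝ P.direction = 2 ∧
      ∀ t ∈ I, f (c t) ∈ P ∧ normalLine f (c t) ≤ P.direction

end Surface

/-- `A` is an open subset of the space `B`, both being sets in three-space. -/
def IsOpenSubsetOf (A B : Set E3) : Prop :=
  ∃ O : Set E3, IsOpen O ∧ A = O ∩ B

/-- `C` is a cylinder `γ × ℝ` over a plane curve: `γ` is a smooth regular simple curve, defined on a
nonempty open interval `I` and lying in a plane `P`, and `C` is the union of the straight lines
through the points of `γ` in the direction of the unit normal `e` of `P`. -/
def IsCylinderOverPlaneCurve (C : Set E3) : Prop :=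
  ∃ (P : AffineSubspace ℝ E3) (e : E3) (I : Set ℝ) (γ : ℝ → E3),
    Module.finrank ℝ P.direction = 2 ∧ ‖e‖ = 1 ∧ e ∈ P.directionᗮ ∧
    IsOpen I ∧ I.OrdConnected ∧ I.Nonempty ∧
    ContDiffOn ℝ ∞ γ I ∧ (∀ t ∈ I, deriv γ t ≠ 0) ∧ Set.InjOn γ I ∧ (∀ t ∈ I, γ t ∈ P) ∧
    C = {x : E3 | ∃ t ∈ I, ∃ s : ℝ, x = γ t + s • e}

/-!
# Surfaces with two planar geodesic foliations

Everything is local until the last step. In a chart the immersion becomes a parametrized surface `g`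
with unit normal `N`, and a planar geodesic foliation becomes a unit vector field `V` with conormal
`m = N × dg V`. Since the plane of a leaf contains the directions of `dg V` and of `N`, the conormal is
normal to that plane, hence constant along the leaf: `dm (V) = 0`. The whole local argument
rests on this equation (`deriv_conormal_eq_zero`), of which the geodesic equation is a consequence.

Differentiating the orthonormal frame `dg V`, `m`, `N` shows that the leaves are lines of curvature,
`dN (V) = -k dg (V)`. With two foliations, the symmetry of the second fundamental form gives
`(k₁ - k₂) ⟨dg V₁, dg V₂⟩ = 0`. So a point at which they cross obliquely is an umbilic. Where they are
orthogonal on an open set, the fields `V₁` and `V₂` commute, and commuting the derivatives of `dg V₁`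
and of `N` gives `k₁ k₂ = 0` (the surface is flat) and `dk₂ (V₁) = 0`
(`normalCurvature_mul_of_orthogonal`, `fderiv_normalCurvature_of_orthogonal`).

* Where `dN` is injective, the oblique crossings are therefore dense, so that the surface is totally
  umbilic and `N + κ g` is constant: it lies in a sphere (`exists_normal_add_smul_eq_const`).
* If `dN` is nowhere injective, some constant vector is tangent to the surface near each point `p`
  (`exists_const_tangent`). This is clear if `dN = 0` near `p`. Otherwise the foliations are orthogonal
  at all points with `dN ≠ 0`, and also at `p`, by continuity. Take `q` near `p` with, say, `k₂ ≠ 0`.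
  As `k₂` is constant along the leaf of the first foliation through `q`, that leaf is a straight line
  orthogonal to the second foliation; so its direction is normal to the planes of all leaves of the
  second foliation that it meets, and these sweep out a neighbourhood of `p` (`exists_crossing`). A
  surface with a constant tangent vector is a graph over its tangent plane that does not depend on
  one of the variables, that is, a cylinder (`exists_cylinder`).

Globally, the set of points near which the surface lies in a given sphere is open, and it is closed
(`eventually_norm_sub_eq_of_frequently`): in the limit `dN` is still injective, with the same center
and radius. By connectedness either the whole surface lies in one sphere, or `dN` is nowhere
injective.
-/

open scoped Manifold ContDiff Topology
open Set

/-! ### Calculus and the equations of a planar geodesic foliation -/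

section Calculus

variable {E F : Type*} [NormedAddCommGroup E] [NormedSpace ℝ E]

/-- Expansion of a vector of three-space in an orthonormal frame. -/
theorem eq_sum_inner_of_orthonormal {a b c : E3} (ha : ‖a‖ = 1) (hb : ‖b‖ = 1) (hc : ‖c‖ = 1)
    (hab : inner ℝ a b = 0) (hac : inner ℝ a c = 0) (hbc : inner ℝ b c = 0) (y : E3) :
    y = inner ℝ y a • a + inner ℝ y b • b + inner ℝ y c • c := by
  have ho : Orthonormal ℝ ![a, b, c] := by
    rw [orthonormal_iff_ite]
    intro i j
    fin_cases i <;> fin_cases j <;>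
      simp [ha, hb, hc, hab, hac, hbc, real_inner_comm a, real_inner_comm b]
  let B := (basisOfOrthonormalOfCardEqFinrank ho (by simp)).toOrthonormalBasis
    (by simpa using ho)
  have h := B.sum_repr' y
  have hB : (B : Fin 3 → E3) = ![a, b, c] := by simp [B]
  rw [Fin.sum_univ_three, hB] at h
  simp only [Matrix.cons_val_zero, Matrix.cons_val_one, Matrix.cons_val] at h
  rw [real_inner_comm a y, real_inner_comm b y, real_inner_comm c y]
  exact h.symm

theorem inner_fderiv_add_inner_fderiv_eq_zero {G H : E → E3} {x : E}
    (hG : DifferentiableAt ℝ G x) (hH : DifferentiableAt ℝ H x) {c : ℝ}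
    (h : ∀ᶠ y in 𝓝 x, inner ℝ (G y) (H y) = c) (v : E) :
    inner ℝ (fderiv ℝ G x v) (H x) + inner ℝ (G x) (fderiv ℝ H x v) = 0 := by
  have h1 : fderiv ℝ (fun y => inner ℝ (G y) (H y)) x = 0 := by
    have : (fun y => inner ℝ (G y) (H y)) =ᶠ[𝓝 x] fun _ => c := h
    rw [this.fderiv_eq]; simp
  have h2 := fderiv_inner_apply ℝ hG hH v
  rw [h1] at h2
  simp at h2
  linarith

theorem inner_fderiv_self_eq_zero {G : E → E3} {x : E} (hG : DifferentiableAt ℝ G x)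
    (h : ∀ᶠ y in 𝓝 x, ‖G y‖ = 1) (v : E) : inner ℝ (fderiv ℝ G x v) (G x) = 0 := by
  have := inner_fderiv_add_inner_fderiv_eq_zero hG hG (c := 1)
    (h.mono fun y hy => by rw [real_inner_self_eq_norm_sq, hy]; norm_num) v
  rw [real_inner_comm (fderiv ℝ G x v)] at this
  linarith

variable [NormedAddCommGroup F] [NormedSpace ℝ F]

theorem ContDiffAt.fderiv_fderiv_comm {G : E → F} {x : E} (hG : ContDiffAt ℝ ∞ G x) (u v : E) :
    fderiv ℝ (fderiv ℝ G) x u v = fderiv ℝ (fderiv ℝ G) x v u :=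
  (hG.isSymmSndFDerivAt (by
    simpa only [minSmoothness_of_isRCLikeNormedField] using ENat.LEInfty.out)) u v

theorem fderiv_fderiv_apply {G : E → F} {V : E → E} {x : E} (hG : ContDiffAt ℝ ∞ G x)
    (hV : DifferentiableAt ℝ V x) (u : E) :
    fderiv ℝ (fun y => fderiv ℝ G y (V y)) x u =
      fderiv ℝ (fderiv ℝ G) x u (V x) + fderiv ℝ G x (fderiv ℝ V x u) := by
  have h1 : DifferentiableAt ℝ (fderiv ℝ G) x :=
    (hG.fderiv_right (m := 1) (WithTop.coe_le_coe.2 le_top)).differentiableAt (by simp)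
  rw [fderiv_clm_apply h1 hV]
  simp [add_comm]

/-- The commutator of the derivatives along two vector fields is the derivative along their
Lie bracket. -/
theorem fderiv_fderiv_sub_fderiv_fderiv {G : E → F} {V W : E → E} {x : E}
    (hG : ContDiffAt ℝ ∞ G x) (hV : DifferentiableAt ℝ V x) (hW : DifferentiableAt ℝ W x) :
    fderiv ℝ (fun y => fderiv ℝ G y (W y)) x (V x) - fderiv ℝ (fun y => fderiv ℝ G y (V y)) x (W x)
      = fderiv ℝ G x (fderiv ℝ W x (V x) - fderiv ℝ V x (W x)) := by
  rw [fderiv_fderiv_apply hG hV, fderiv_fderiv_apply hG hW, hG.fderiv_fderiv_comm (V x) (W x),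
    map_sub]
  abel

end Calculus

/-- `g` is a smooth immersion of the open set `Ω` of the parameter plane in three-space, and `N` is a
smooth unit normal field along it. -/
structure IsParamSurface (Ω : Set E2) (g N : E2 → E3) : Prop where
  isOpen : IsOpen Ω
  smooth : ContDiffOn ℝ ∞ g Ω
  injective : ∀ x ∈ Ω, Function.Injective (fderiv ℝ g x)
  smooth_normal : ContDiffOn ℝ ∞ N Ω
  norm_normal : ∀ x ∈ Ω, ‖N x‖ = 1
  inner_normal : ∀ x ∈ Ω, ∀ v, inner ℝ (fderiv ℝ g x v) (N x) = 0

/-- The vector field `V` on `Ω` has unit length for the metric induced by `g` and is tangent to a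
planar geodesic foliation. The field `m` is the unit conormal, so that `dg V`, `m`, `N` is an
orthonormal frame; the plane of the leaf through `x` is orthogonal to `m x`, whence `m` is constant
along the leaves. -/
structure IsPlanarField (Ω : Set E2) (g N : E2 → E3) (V : E2 → E2) (m : E2 → E3) : Prop where
  smooth : ContDiffOn ℝ ∞ V Ω
  smooth_conormal : ContDiffOn ℝ ∞ m Ω
  norm_dir : ∀ x ∈ Ω, ‖fderiv ℝ g x (V x)‖ = 1
  norm_conormal : ∀ x ∈ Ω, ‖m x‖ = 1
  inner_conormal_normal : ∀ x ∈ Ω, inner ℝ (m x) (N x) = 0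
  inner_dir_conormal : ∀ x ∈ Ω, inner ℝ (fderiv ℝ g x (V x)) (m x) = 0
  fderiv_conormal : ∀ x ∈ Ω, fderiv ℝ m x (V x) = 0

/-- The normal curvature of the surface in the direction of the unit field `V`. -/
noncomputable def normalCurvature (g N : E2 → E3) (V : E2 → E2) (x : E2) : ℝ :=
  -inner ℝ (fderiv ℝ N x (V x)) (fderiv ℝ g x (V x))

section LocalTheory

variable {Ω : Set E2} {g N : E2 → E3} {V V₁ V₂ : E2 → E2} {m m₁ m₂ : E2 → E3} {x : E2}

theorem IsParamSurface.mem_nhds (hS : IsParamSurface Ω g N) (hx : x ∈ Ω) : Ω ∈ 𝓝 x :=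
  hS.isOpen.mem_nhds hx

theorem IsParamSurface.contDiffAt (hS : IsParamSurface Ω g N) (hx : x ∈ Ω) : ContDiffAt ℝ ∞ g x :=
  hS.smooth.contDiffAt (hS.mem_nhds hx)

theorem IsParamSurface.contDiffAt_normal (hS : IsParamSurface Ω g N) (hx : x ∈ Ω) :
    ContDiffAt ℝ ∞ N x :=
  hS.smooth_normal.contDiffAt (hS.mem_nhds hx)

theorem IsParamSurface.mono (hS : IsParamSurface Ω g N) {Ω' : Set E2} (ho : IsOpen Ω')
    (hs : Ω' ⊆ Ω) : IsParamSurface Ω' g N :=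
  ⟨ho, hS.smooth.mono hs, fun x hx => hS.injective x (hs hx), hS.smooth_normal.mono hs,
    fun x hx => hS.norm_normal x (hs hx), fun x hx => hS.inner_normal x (hs hx)⟩

theorem IsPlanarField.mono (h : IsPlanarField Ω g N V m) {Ω' : Set E2} (hs : Ω' ⊆ Ω) :
    IsPlanarField Ω' g N V m :=
  ⟨h.smooth.mono hs, h.smooth_conormal.mono hs, fun x hx => h.norm_dir x (hs hx),
    fun x hx => h.norm_conormal x (hs hx), fun x hx => h.inner_conormal_normal x (hs hx),
    fun x hx => h.inner_dir_conormal x (hs hx), fun x hx => h.fderiv_conormal x (hs hx)⟩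

theorem IsPlanarField.contDiffAt (hS : IsParamSurface Ω g N) (h : IsPlanarField Ω g N V m)
    (hx : x ∈ Ω) : ContDiffAt ℝ ∞ V x :=
  h.smooth.contDiffAt (hS.mem_nhds hx)

theorem IsPlanarField.differentiableAt (hS : IsParamSurface Ω g N) (h : IsPlanarField Ω g N V m)
    (hx : x ∈ Ω) : DifferentiableAt ℝ V x :=
  (h.contDiffAt hS hx).differentiableAt (by simp)

theorem IsPlanarField.contDiffAt_conormal (hS : IsParamSurface Ω g N)
    (h : IsPlanarField Ω g N V m) (hx : x ∈ Ω) : ContDiffAt ℝ ∞ m x :=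
  h.smooth_conormal.contDiffAt (hS.mem_nhds hx)

theorem IsPlanarField.contDiffAt_dir (hS : IsParamSurface Ω g N) (h : IsPlanarField Ω g N V m)
    (hx : x ∈ Ω) : ContDiffAt ℝ ∞ (fun y => fderiv ℝ g y (V y)) x :=
  ((hS.contDiffAt hx).fderiv_right (m := ∞) (by simp)).clm_apply (h.contDiffAt hS hx)

theorem IsPlanarField.contDiffAt_normalCurvature (hS : IsParamSurface Ω g N)
    (h : IsPlanarField Ω g N V m) (hx : x ∈ Ω) : ContDiffAt ℝ ∞ (normalCurvature g N V) x :=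
  ((((hS.contDiffAt_normal hx).fderiv_right (m := ∞) (by simp)).clm_apply
    (h.contDiffAt hS hx)).inner ℝ (h.contDiffAt_dir hS hx)).neg

theorem IsParamSurface.inner_fderiv_normal_self (hS : IsParamSurface Ω g N) (hx : x ∈ Ω) (v : E2) :
    inner ℝ (fderiv ℝ N x v) (N x) = 0 :=
  inner_fderiv_self_eq_zero ((hS.contDiffAt_normal hx).differentiableAt (by simp))
    (Filter.eventually_of_mem (hS.mem_nhds hx) hS.norm_normal) v

/-- Expansion in the frame `dg V`, `m`, `N`. -/
theorem IsPlanarField.expand (hS : IsParamSurface Ω g N) (h : IsPlanarField Ω g N V m)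
    (hx : x ∈ Ω) (y : E3) :
    y = inner ℝ y (fderiv ℝ g x (V x)) • fderiv ℝ g x (V x) + inner ℝ y (m x) • m x
      + inner ℝ y (N x) • N x :=
  eq_sum_inner_of_orthonormal (h.norm_dir x hx) (h.norm_conormal x hx) (hS.norm_normal x hx)
    (h.inner_dir_conormal x hx) (hS.inner_normal x hx _) (h.inner_conormal_normal x hx) y

/-- The leaves are lines of curvature (Joachimsthal). -/
theorem IsPlanarField.fderiv_normal (hS : IsParamSurface Ω g N) (h : IsPlanarField Ω g N V m)
    (hx : x ∈ Ω) :
    fderiv ℝ N x (V x) = -normalCurvature g N V x • fderiv ℝ g x (V x) := by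
  have h1 := inner_fderiv_add_inner_fderiv_eq_zero
    ((hS.contDiffAt_normal hx).differentiableAt (by simp))
    ((h.contDiffAt_conormal hS hx).differentiableAt (by simp)) (c := 0)
    (Filter.eventually_of_mem (hS.mem_nhds hx) fun y hy => by
      rw [real_inner_comm]; exact h.inner_conormal_normal y hy) (V x)
  rw [h.fderiv_conormal x hx, inner_zero_right, add_zero] at h1
  have h2 := h.expand hS hx (fderiv ℝ N x (V x))
  rw [h1, hS.inner_fderiv_normal_self hx] at h2
  simpa [normalCurvature] using h2

/-- The leaves are geodesics: their acceleration is normal to the surface. -/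
theorem IsPlanarField.fderiv_dir (hS : IsParamSurface Ω g N) (h : IsPlanarField Ω g N V m)
    (hx : x ∈ Ω) :
    fderiv ℝ (fun y => fderiv ℝ g y (V y)) x (V x) = normalCurvature g N V x • N x := by
  have hd := (h.contDiffAt_dir hS hx).differentiableAt (by simp)
  have h0 := inner_fderiv_self_eq_zero hd
    (Filter.eventually_of_mem (hS.mem_nhds hx) h.norm_dir) (V x)
  have h1 := inner_fderiv_add_inner_fderiv_eq_zero hd
    ((h.contDiffAt_conormal hS hx).differentiableAt (by simp)) (c := 0)
    (Filter.eventually_of_mem (hS.mem_nhds hx) h.inner_dir_conormal) (V x)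
  have h2 := inner_fderiv_add_inner_fderiv_eq_zero hd
    ((hS.contDiffAt_normal hx).differentiableAt (by simp)) (c := 0)
    (Filter.eventually_of_mem (hS.mem_nhds hx) fun y hy => hS.inner_normal y hy _) (V x)
  rw [h.fderiv_conormal x hx, inner_zero_right, add_zero] at h1
  have h3 := h.expand hS hx (fderiv ℝ (fun y => fderiv ℝ g y (V y)) x (V x))
  have h4 : inner ℝ (fderiv ℝ (fun y => fderiv ℝ g y (V y)) x (V x)) (N x)
      = normalCurvature g N V x := by
    rw [normalCurvature, real_inner_comm (fderiv ℝ g x (V x))]; linarith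
  rw [h0, h1, h4] at h3
  simpa using h3

/-- Symmetry of the second fundamental form. -/
theorem IsParamSurface.inner_fderiv_normal_comm (hS : IsParamSurface Ω g N) (hx : x ∈ Ω)
    (u v : E2) :
    inner ℝ (fderiv ℝ N x u) (fderiv ℝ g x v) = inner ℝ (fderiv ℝ N x v) (fderiv ℝ g x u) := by
  have key : ∀ u v, inner ℝ (fderiv ℝ N x u) (fderiv ℝ g x v)
      = - inner ℝ (fderiv ℝ (fderiv ℝ g) x u v) (N x) := by
    intro u v
    have hd : DifferentiableAt ℝ (fun y => fderiv ℝ g y v) x :=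
      (((hS.contDiffAt hx).fderiv_right (m := 1) (WithTop.coe_le_coe.2 le_top)).differentiableAt
        (by simp)).clm_apply (differentiableAt_const v)
    have h1 := inner_fderiv_add_inner_fderiv_eq_zero hd
      ((hS.contDiffAt_normal hx).differentiableAt (by simp)) (c := 0)
      (Filter.eventually_of_mem (hS.mem_nhds hx) fun y hy => hS.inner_normal y hy v) u
    rw [fderiv_fderiv_apply (V := fun _ => v) (hS.contDiffAt hx) (differentiableAt_const v)] at h1
    simp only [fderiv_fun_const, Pi.zero_apply, zero_apply, map_zero,
      add_zero] at h1
    rw [real_inner_comm]; linarith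
  rw [key, key, (hS.contDiffAt hx).fderiv_fderiv_comm]

/-- At a point where the two directions are not orthogonal, the principal curvatures agree. -/
theorem normalCurvature_sub_mul_inner (hS : IsParamSurface Ω g N)
    (h₁ : IsPlanarField Ω g N V₁ m₁) (h₂ : IsPlanarField Ω g N V₂ m₂) (hx : x ∈ Ω) :
    (normalCurvature g N V₁ x - normalCurvature g N V₂ x)
      * inner ℝ (fderiv ℝ g x (V₁ x)) (fderiv ℝ g x (V₂ x)) = 0 := by
  have h := hS.inner_fderiv_normal_comm hx (V₁ x) (V₂ x)
  rw [h₁.fderiv_normal hS hx, h₂.fderiv_normal hS hx, inner_smul_left, inner_smul_left,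
    real_inner_comm (fderiv ℝ g x (V₁ x)) (fderiv ℝ g x (V₂ x))] at h
  simp only [map_neg, conj_trivial] at h
  linarith

section Orthogonal

/-- If the two foliations are orthogonal, the direction of each is constant, as a vector of three-space,
along the leaves of the other: it is the conormal of those leaves, up to sign. -/
theorem fderiv_dir_of_orthogonal (hS : IsParamSurface Ω g N)
    (h₁ : IsPlanarField Ω g N V₁ m₁) (h₂ : IsPlanarField Ω g N V₂ m₂)
    (horth : ∀ y ∈ Ω, inner ℝ (fderiv ℝ g y (V₁ y)) (fderiv ℝ g y (V₂ y)) = 0) (hx : x ∈ Ω) :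
    fderiv ℝ (fun y => fderiv ℝ g y (V₂ y)) x (V₁ x) = 0 := by
  have hd₁ := (h₁.contDiffAt_dir hS hx).differentiableAt (by simp)
  have hd₂ := (h₂.contDiffAt_dir hS hx).differentiableAt (by simp)
  have hm := (h₁.contDiffAt_conormal hS hx).differentiableAt (by simp)
  have hnear : ∀ {P : E2 → Prop}, (∀ y ∈ Ω, P y) → ∀ᶠ y in 𝓝 x, P y :=
    fun hP => Filter.eventually_of_mem (hS.mem_nhds hx) hP
  have a1 := inner_fderiv_add_inner_fderiv_eq_zero hd₁ hd₂ (hnear horth) (V₁ x)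
  have a2 := inner_fderiv_add_inner_fderiv_eq_zero hd₂
    ((hS.contDiffAt_normal hx).differentiableAt (by simp))
    (hnear fun y hy => hS.inner_normal y hy _) (V₁ x)
  rw [h₁.fderiv_dir hS hx, inner_smul_left, real_inner_comm, hS.inner_normal x hx] at a1
  rw [h₁.fderiv_normal hS hx, inner_smul_right, real_inner_comm,
    real_inner_comm _ (fderiv ℝ g x (V₂ x)), horth x hx] at a2
  -- The field `dg V₂` equals `± m₁`; squaring the coefficient avoids the choice of the sign.
  have hsq : ∀ y ∈ Ω, inner ℝ (fderiv ℝ g y (V₂ y)) (m₁ y) ^ 2 = 1 := by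
    intro y hy
    have e := h₁.expand hS hy (fderiv ℝ g y (V₂ y))
    rw [hS.inner_normal y hy, real_inner_comm, horth y hy] at e
    have n := h₂.norm_dir y hy
    rw [e] at n
    simp only [zero_smul, zero_add, add_zero, norm_smul, h₁.norm_conormal y hy, mul_one,
      Real.norm_eq_abs] at n
    rw [← sq_abs, n, one_pow]
  have a3 : inner ℝ (fderiv ℝ (fun y => fderiv ℝ g y (V₂ y)) x (V₁ x)) (m₁ x) = 0 := by
    have e1 : fderiv ℝ (fun y => inner ℝ (fderiv ℝ g y (V₂ y)) (m₁ y) ^ 2) x = 0 := by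
      have : (fun y => inner ℝ (fderiv ℝ g y (V₂ y)) (m₁ y) ^ 2) =ᶠ[𝓝 x] fun _ => (1 : ℝ) :=
        hnear hsq
      rw [this.fderiv_eq]; simp
    rw [fderiv_fun_pow 2 (hd₂.inner ℝ hm)] at e1
    have e2 := congrArg (fun l : E2 →L[ℝ] ℝ => l (V₁ x)) e1
    simp only [smul_apply, fderiv_inner_apply ℝ hd₂ hm,
      h₁.fderiv_conormal x hx, inner_zero_right, zero_add, zero_apply,
      smul_eq_mul, mul_eq_zero] at e2
    have hne := hsq x hx
    rcases e2 with e2 | e2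
    · exfalso
      have : inner ℝ (fderiv ℝ g x (V₂ x)) (m₁ x) = 0 := by simpa using e2
      rw [this] at hne; norm_num at hne
    · exact e2
  rw [h₁.expand hS hx (fderiv ℝ (fun y => fderiv ℝ g y (V₂ y)) x (V₁ x)), a3]
  have a1' : inner ℝ (fderiv ℝ (fun y => fderiv ℝ g y (V₂ y)) x (V₁ x))
      (fderiv ℝ g x (V₁ x)) = 0 := by
    rw [real_inner_comm]; simpa using a1
  have a2' : inner ℝ (fderiv ℝ (fun y => fderiv ℝ g y (V₂ y)) x (V₁ x)) (N x) = 0 := by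
    rw [real_inner_comm]; simpa using a2
  rw [a1', a2']; simp

/-- The unit vector fields of two orthogonal planar geodesic foliations commute. -/
theorem fderiv_field_comm_of_orthogonal (hS : IsParamSurface Ω g N)
    (h₁ : IsPlanarField Ω g N V₁ m₁) (h₂ : IsPlanarField Ω g N V₂ m₂)
    (horth : ∀ y ∈ Ω, inner ℝ (fderiv ℝ g y (V₁ y)) (fderiv ℝ g y (V₂ y)) = 0) (hx : x ∈ Ω) :
    fderiv ℝ V₂ x (V₁ x) - fderiv ℝ V₁ x (V₂ x) = 0 := by
  have h := fderiv_fderiv_sub_fderiv_fderiv (hS.contDiffAt hx) (h₁.differentiableAt hS hx)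
    (h₂.differentiableAt hS hx)
  rw [fderiv_dir_of_orthogonal hS h₁ h₂ horth hx, fderiv_dir_of_orthogonal hS h₂ h₁
    (fun y hy => by rw [real_inner_comm]; exact horth y hy) hx, sub_zero] at h
  exact hS.injective x hx (by rw [← h, map_zero])

/-- If the two foliations are orthogonal, each principal curvature is constant along the leaves of
the other foliation: this is the Codazzi equation in a flat orthogonal net. -/
theorem fderiv_normalCurvature_of_orthogonal (hS : IsParamSurface Ω g N)
    (h₁ : IsPlanarField Ω g N V₁ m₁) (h₂ : IsPlanarField Ω g N V₂ m₂)
    (horth : ∀ y ∈ Ω, inner ℝ (fderiv ℝ g y (V₁ y)) (fderiv ℝ g y (V₂ y)) = 0) (hx : x ∈ Ω) :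
    fderiv ℝ (normalCurvature g N V₂) x (V₁ x) = 0 := by
  have horth' : ∀ y ∈ Ω, inner ℝ (fderiv ℝ g y (V₂ y)) (fderiv ℝ g y (V₁ y)) = 0 :=
    fun y hy => by rw [real_inner_comm]; exact horth y hy
  have h := fderiv_fderiv_sub_fderiv_fderiv (hS.contDiffAt_normal hx) (h₁.differentiableAt hS hx)
    (h₂.differentiableAt hS hx)
  rw [fderiv_field_comm_of_orthogonal hS h₁ h₂ horth hx, map_zero] at h
  have aux : ∀ {V W : E2 → E2} {m n : E2 → E3}, IsPlanarField Ω g N V m → IsPlanarField Ω g N W n →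
      (∀ y ∈ Ω, inner ℝ (fderiv ℝ g y (V y)) (fderiv ℝ g y (W y)) = 0) →
      fderiv ℝ (fun y => fderiv ℝ N y (W y)) x (V x) =
        -fderiv ℝ (normalCurvature g N W) x (V x) • fderiv ℝ g x (W x) := by
    intro V W m n hV hW ho
    have e : (fun y => fderiv ℝ N y (W y)) =ᶠ[𝓝 x]
        fun y => -(normalCurvature g N W y • fderiv ℝ g y (W y)) :=
      Filter.eventually_of_mem (hS.mem_nhds hx) fun y hy => by
        show fderiv ℝ N y (W y) = _
        rw [hW.fderiv_normal hS hy, neg_smul]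
    rw [e.fderiv_eq, fderiv_fun_neg, fderiv_fun_smul
      ((hW.contDiffAt_normalCurvature hS hx).differentiableAt (by simp))
      ((hW.contDiffAt_dir hS hx).differentiableAt (by simp))]
    simp [fderiv_dir_of_orthogonal hS hV hW ho hx]
  rw [aux h₁ h₂ horth, aux h₂ h₁ horth'] at h
  have h' := congrArg (fun z => inner ℝ z (fderiv ℝ g x (V₂ x))) h
  simp only [inner_sub_left, inner_smul_left, horth x hx, inner_zero_left,
    real_inner_self_eq_norm_sq, h₂.norm_dir x hx] at h'
  simpa using h'

/-- If the two foliations are orthogonal, the surface is flat. -/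
theorem normalCurvature_mul_of_orthogonal (hS : IsParamSurface Ω g N)
    (h₁ : IsPlanarField Ω g N V₁ m₁) (h₂ : IsPlanarField Ω g N V₂ m₂)
    (horth : ∀ y ∈ Ω, inner ℝ (fderiv ℝ g y (V₁ y)) (fderiv ℝ g y (V₂ y)) = 0) (hx : x ∈ Ω) :
    normalCurvature g N V₁ x * normalCurvature g N V₂ x = 0 := by
  have horth' : ∀ y ∈ Ω, inner ℝ (fderiv ℝ g y (V₂ y)) (fderiv ℝ g y (V₁ y)) = 0 :=
    fun y hy => by rw [real_inner_comm]; exact horth y hy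
  have h := fderiv_fderiv_sub_fderiv_fderiv (h₁.contDiffAt_dir hS hx) (h₁.differentiableAt hS hx)
    (h₂.differentiableAt hS hx)
  rw [fderiv_field_comm_of_orthogonal hS h₁ h₂ horth hx, map_zero] at h
  have e1 : (fun y => fderiv ℝ (fun y => fderiv ℝ g y (V₁ y)) y (V₂ y)) =ᶠ[𝓝 x] fun _ => (0 : E3) :=
    Filter.eventually_of_mem (hS.mem_nhds hx) fun y hy =>
      fderiv_dir_of_orthogonal hS h₂ h₁ horth' hy
  have e2 : (fun y => fderiv ℝ (fun y => fderiv ℝ g y (V₁ y)) y (V₁ y)) =ᶠ[𝓝 x]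
      fun y => normalCurvature g N V₁ y • N y :=
    Filter.eventually_of_mem (hS.mem_nhds hx) fun y hy => h₁.fderiv_dir hS hy
  rw [e1.fderiv_eq, e2.fderiv_eq, fderiv_fun_smul
      ((h₁.contDiffAt_normalCurvature hS hx).differentiableAt (by simp))
      ((hS.contDiffAt_normal hx).differentiableAt (by simp))] at h
  have h' := congrArg (fun z => inner ℝ z (fderiv ℝ g x (V₂ x))) h
  simp only [fderiv_fun_const, Pi.zero_apply, zero_apply, inner_sub_left,
    inner_zero_left, add_apply, smul_apply,
    h₂.fderiv_normal hS hx, ContinuousLinearMap.smulRight_apply, inner_add_left, inner_smul_left,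
    real_inner_self_eq_norm_sq, h₂.norm_dir x hx] at h'
  rw [real_inner_comm, hS.inner_normal x hx] at h'
  simpa using h'

end Orthogonal

end LocalTheory

/-! ### Oblique crossings and umbilics -/

section Umbilic

variable {Ω : Set E2} {g N : E2 → E3} {V₁ V₂ : E2 → E2} {m₁ m₂ : E2 → E3} {x : E2}

/-- The cosine of the angle between the vector fields `V₁` and `V₂`, in the metric induced by
`g`. -/
noncomputable def cosAngle (g : E2 → E3) (V₁ V₂ : E2 → E2) (x : E2) : ℝ :=
  inner ℝ (fderiv ℝ g x (V₁ x)) (fderiv ℝ g x (V₂ x))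

theorem cosAngle_comm : cosAngle g V₁ V₂ x = cosAngle g V₂ V₁ x := real_inner_comm _ _

theorem continuousOn_cosAngle (hS : IsParamSurface Ω g N) (h₁ : IsPlanarField Ω g N V₁ m₁)
    (h₂ : IsPlanarField Ω g N V₂ m₂) : ContinuousOn (cosAngle g V₁ V₂) Ω := fun _ hx =>
  (((h₁.contDiffAt_dir hS hx).inner ℝ (h₂.contDiffAt_dir hS hx)).continuousAt).continuousWithinAt

theorem linearIndependent_of_cosAngle (h₁ : IsPlanarField Ω g N V₁ m₁)
    (h₂ : IsPlanarField Ω g N V₂ m₂) (hx : x ∈ Ω) (hc : cosAngle g V₁ V₂ x ^ 2 ≠ 1) :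
    LinearIndependent ℝ ![V₁ x, V₂ x] := by
  rw [LinearIndependent.pair_iff]
  intro s t hst
  have e := congrArg (fderiv ℝ g x) hst
  simp only [map_add, map_smul, map_zero] at e
  have e1 := congrArg (fun z => inner ℝ z (fderiv ℝ g x (V₁ x))) e
  have e2 := congrArg (fun z => inner ℝ z (fderiv ℝ g x (V₂ x))) e
  simp only [inner_add_left, inner_smul_left, real_inner_self_eq_norm_sq, h₁.norm_dir x hx,
    h₂.norm_dir x hx, inner_zero_left, conj_trivial] at e1 e2
  rw [real_inner_comm] at e1
  change s * 1 ^ 2 + t * cosAngle g V₁ V₂ x = 0 at e1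
  change s * cosAngle g V₁ V₂ x + t * 1 ^ 2 = 0 at e2
  have hs : s * (cosAngle g V₁ V₂ x ^ 2 - 1) = 0 := by
    linear_combination cosAngle g V₁ V₂ x * e2 - e1
  have hs0 : s = 0 := (mul_eq_zero.1 hs).resolve_right (sub_ne_zero.2 hc)
  refine ⟨hs0, ?_⟩
  rw [hs0] at e2
  linarith

theorem ContinuousLinearMap.eq_of_linearIndependent_pair {u v : E2}
    (h : LinearIndependent ℝ ![u, v]) {A B : E2 →L[ℝ] E3} (hu : A u = B u) (hv : A v = B v) :
    A = B := by
  have hs := h.span_eq_top_of_card_eq_finrank' (by simp)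
  apply ContinuousLinearMap.coe_injective
  apply LinearMap.ext_on_range hs
  intro i
  fin_cases i
  · exact hu
  · exact hv

/-- Two planar geodesic foliations that cross at an oblique angle force an umbilic. -/
theorem fderiv_normal_eq_of_oblique (hS : IsParamSurface Ω g N) (h₁ : IsPlanarField Ω g N V₁ m₁)
    (h₂ : IsPlanarField Ω g N V₂ m₂) (hx : x ∈ Ω) (hc : cosAngle g V₁ V₂ x ^ 2 ≠ 1)
    (h0 : cosAngle g V₁ V₂ x ≠ 0) (v : E2) :
    fderiv ℝ N x v = -normalCurvature g N V₁ x • fderiv ℝ g x v := by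
  have hk := (mul_eq_zero.1 (normalCurvature_sub_mul_inner hS h₁ h₂ hx)).resolve_right h0
  refine DFunLike.congr_fun (ContinuousLinearMap.eq_of_linearIndependent_pair
    (B := -normalCurvature g N V₁ x • fderiv ℝ g x)
    (linearIndependent_of_cosAngle h₁ h₂ hx hc) (h₁.fderiv_normal hS hx) ?_) v
  rw [h₂.fderiv_normal hS hx, ← sub_eq_zero.1 hk]
  rfl

theorem IsPlanarField.dir_ne_zero (h₁ : IsPlanarField Ω g N V₁ m₁) (hx : x ∈ Ω) : V₁ x ≠ 0 := by
  intro h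
  have := h₁.norm_dir x hx
  rw [h] at this
  simp at this

theorem IsPlanarField.normalCurvature_ne_zero (hS : IsParamSurface Ω g N)
    (h₁ : IsPlanarField Ω g N V₁ m₁) (hx : x ∈ Ω) (hi : Function.Injective (fderiv ℝ N x)) :
    normalCurvature g N V₁ x ≠ 0 := by
  intro h
  have e := h₁.fderiv_normal hS hx
  rw [h, neg_zero, zero_smul] at e
  exact h₁.dir_ne_zero hx (hi (by rw [e, map_zero]))

/-- Where the Gauss map is an immersion, the surface is totally umbilic, hence spherical: the
function `N + κ g` is constant for some nonzero constant `κ`. -/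
theorem exists_normal_add_smul_eq_const (hS : IsParamSurface Ω g N)
    (h₁ : IsPlanarField Ω g N V₁ m₁) (h₂ : IsPlanarField Ω g N V₂ m₂)
    (hD : ∀ W ⊆ Ω, IsOpen W → W.Nonempty → ∃ y ∈ W, cosAngle g V₁ V₂ y ^ 2 ≠ 1)
    (hx : x ∈ Ω) (hi : Function.Injective (fderiv ℝ N x)) :
    ∃ κ : ℝ, κ ≠ 0 ∧ ∃ a : E3, ∀ᶠ y in 𝓝 x, N y + κ • g y = a := by
  have hcontN : ContinuousOn (fderiv ℝ N) Ω := fun y hy =>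
    ((hS.contDiffAt_normal hy).fderiv_right (m := ∞) (by simp)).continuousAt.continuousWithinAt
  have hcontg : ContinuousOn (fderiv ℝ g) Ω := fun y hy =>
    ((hS.contDiffAt hy).fderiv_right (m := ∞) (by simp)).continuousAt.continuousWithinAt
  have hcontk : ContinuousOn (normalCurvature g N V₁) Ω := fun y hy =>
    (h₁.contDiffAt_normalCurvature hS hy).continuousAt.continuousWithinAt
  have hOpen : IsOpen (Ω ∩ fderiv ℝ N ⁻¹' {A | Function.Injective A}) :=
    hcontN.isOpen_inter_preimage hS.isOpen ContinuousLinearMap.isOpen_injective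
  obtain ⟨r, hr, hball⟩ := Metric.isOpen_iff.1 hOpen x ⟨hx, hi⟩
  set B := Metric.ball x r with hB
  have hBΩ : B ⊆ Ω := fun y hy => (hball hy).1
  have humb : ∀ y ∈ B, fderiv ℝ N y + normalCurvature g N V₁ y • fderiv ℝ g y = 0 := by
    intro y hy
    by_contra hne
    have hcont : ContinuousOn (fun y => fderiv ℝ N y + normalCurvature g N V₁ y • fderiv ℝ g y) B :=
      (hcontN.add (hcontk.smul hcontg)).mono hBΩ
    have hW := hcont.isOpen_inter_preimage Metric.isOpen_ball (isOpen_ne (x := 0))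
    set W := B ∩ (fun y => fderiv ℝ N y + normalCurvature g N V₁ y • fderiv ℝ g y) ⁻¹' {z | z ≠ 0}
      with hWdef
    have hWΩ : W ⊆ Ω := fun z hz => hBΩ hz.1
    have hW' : IsOpen (W ∩ cosAngle g V₁ V₂ ⁻¹' {c | c ^ 2 ≠ 1}) :=
      ((continuousOn_cosAngle hS h₁ h₂).mono hWΩ).isOpen_inter_preimage hW
        (isOpen_ne.preimage (continuous_pow 2))
    obtain ⟨z, hz, hzc⟩ := hD W hWΩ hW ⟨y, hy, hne⟩
    -- The foliations are orthogonal on an open set, which makes `dN` degenerate there.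
    have horth : ∀ w ∈ W ∩ cosAngle g V₁ V₂ ⁻¹' {c | c ^ 2 ≠ 1}, cosAngle g V₁ V₂ w = 0 := by
      intro w hw
      by_contra h0
      apply hw.1.2
      ext1 v
      change fderiv ℝ N w v + normalCurvature g N V₁ w • fderiv ℝ g w v = 0
      rw [fderiv_normal_eq_of_oblique hS h₁ h₂ (hWΩ hw.1) hw.2 h0, neg_smul, neg_add_cancel]
    have hzW : z ∈ W ∩ cosAngle g V₁ V₂ ⁻¹' {c | c ^ 2 ≠ 1} := ⟨hz, hzc⟩
    have hsub : W ∩ cosAngle g V₁ V₂ ⁻¹' {c | c ^ 2 ≠ 1} ⊆ Ω := fun w hw => hWΩ hw.1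
    have hk := normalCurvature_mul_of_orthogonal (hS.mono hW' hsub) (h₁.mono hsub) (h₂.mono hsub)
      horth hzW
    exact mul_ne_zero (h₁.normalCurvature_ne_zero hS (hWΩ hz) (hball hz.1).2)
      (h₂.normalCurvature_ne_zero hS (hWΩ hz) (hball hz.1).2) hk
  -- The Codazzi equation: differentiate `dN = -k dg` and use the symmetry of second derivatives.
  have hdk : EqOn (fderiv ℝ (normalCurvature g N V₁)) 0 B := by
    intro y hy
    have hyΩ := hBΩ hy
    have key : ∀ u v, fderiv ℝ (fderiv ℝ N) y u v =
        -(normalCurvature g N V₁ y • fderiv ℝ (fderiv ℝ g) y u v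
          + fderiv ℝ (normalCurvature g N V₁) y u • fderiv ℝ g y v) := by
      intro u v
      have e : (fun z => fderiv ℝ N z v) =ᶠ[𝓝 y]
          fun z => -(normalCurvature g N V₁ z • fderiv ℝ g z v) :=
        Filter.eventually_of_mem (Metric.isOpen_ball.mem_nhds hy) fun z hz => by
          have := congrArg (fun A : E2 →L[ℝ] E3 => A v) (humb z hz)
          exact eq_neg_of_add_eq_zero_left this
      have e1 := e.fderiv_eq (𝕜 := ℝ)
      have hdg : DifferentiableAt ℝ (fun z => fderiv ℝ g z v) y :=
        (((hS.contDiffAt hyΩ).fderiv_right (m := 1)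
          (WithTop.coe_le_coe.2 le_top)).differentiableAt (by simp)).clm_apply
          (differentiableAt_const v)
      rw [fderiv_fun_neg, fderiv_fun_smul
        ((h₁.contDiffAt_normalCurvature hS hyΩ).differentiableAt (by simp)) hdg] at e1
      have e2 := congrArg (fun A : E2 →L[ℝ] E3 => A u) e1
      simp only [fderiv_fderiv_apply (V := fun _ => v) (hS.contDiffAt_normal hyΩ)
        (differentiableAt_const v), neg_apply, add_apply, smul_apply,
        ContinuousLinearMap.smulRight_apply, fderiv_fderiv_apply (V := fun _ => v)
        (hS.contDiffAt hyΩ) (differentiableAt_const v)] at e2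
      simpa using e2
    have hcomm : ∀ u v, fderiv ℝ (normalCurvature g N V₁) y u • v =
        fderiv ℝ (normalCurvature g N V₁) y v • u := by
      intro u v
      apply hS.injective y hyΩ
      have e := (hS.contDiffAt_normal hyΩ).fderiv_fderiv_comm u v
      rw [key, key, (hS.contDiffAt hyΩ).fderiv_fderiv_comm u v] at e
      simpa using e
    ext u
    by_contra hu
    have hu' : fderiv ℝ (normalCurvature g N V₁) y u ≠ 0 := hu
    have := finrank_le_one (R := ℝ) u fun w =>
      ⟨(fderiv ℝ (normalCurvature g N V₁) y u)⁻¹ * fderiv ℝ (normalCurvature g N V₁) y w, by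
        rw [mul_smul, ← hcomm, smul_smul, inv_mul_cancel₀ hu', one_smul]⟩
    simp at this
  have hpre : IsPreconnected B := (convex_ball x r).isPreconnected
  have hxB : x ∈ B := Metric.mem_ball_self hr
  set κ := normalCurvature g N V₁ x
  have hκ : ∀ y ∈ B, normalCurvature g N V₁ y = κ := fun y hy =>
    Metric.isOpen_ball.is_const_of_fderiv_eq_zero hpre
      (fun z hz => ((h₁.contDiffAt_normalCurvature hS (hBΩ hz)).differentiableAt
        (by simp)).differentiableWithinAt) hdk hy hxB
  refine ⟨κ, h₁.normalCurvature_ne_zero hS hx hi, ?_⟩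
  have hdiff : ∀ y ∈ B, DifferentiableAt ℝ g y := fun y hy =>
    (hS.contDiffAt (hBΩ hy)).differentiableAt (by simp)
  have hdiffN : ∀ y ∈ B, DifferentiableAt ℝ N y := fun y hy =>
    (hS.contDiffAt_normal (hBΩ hy)).differentiableAt (by simp)
  obtain ⟨a, ha⟩ := Metric.isOpen_ball.exists_is_const_of_fderiv_eq_zero (𝕜 := ℝ)
    (f := fun y => N y + κ • g y) hpre
    (fun y hy => ((hdiffN y hy).add ((hdiff y hy).const_smul κ)).differentiableWithinAt)
    (fun y hy => by
      rw [fderiv_fun_add (hdiffN y hy) ((hdiff y hy).fun_const_smul κ),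
        fderiv_fun_const_smul (hdiff y hy)]
      have := humb y hy
      rwa [hκ y hy] at this)
  exact ⟨a, Filter.eventually_of_mem (Metric.isOpen_ball.mem_nhds hxB) ha⟩

end Umbilic

/-! ### Integral curves of transverse vector fields -/

section IntegralCurves

/-- Integral curves of a smooth vector field exist for a uniform time near a point. -/
theorem exists_integralCurves {Ω : Set E2} (hΩ : IsOpen Ω) {V : E2 → E2}
    (hV : ContDiffOn ℝ ∞ V Ω) {p : E2} (hp : p ∈ Ω) :
    ∃ r > 0, ∃ ε > 0, ∀ x ∈ Metric.ball p r, ∃ c : ℝ → E2, c 0 = x ∧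
      ∀ t ∈ Ioo (-ε) ε, c t ∈ Ω ∧ HasDerivAt c (V (c t)) t := by
  have hV1 : ContDiffAt ℝ 1 V p :=
    (hV.contDiffAt (hΩ.mem_nhds hp)).of_le (WithTop.coe_le_coe.2 le_top)
  obtain ⟨ε, hε, a, r, L, K, hr, hpl⟩ := IsPicardLindelof.of_contDiffAt_one hV1
  obtain ⟨α, hα, hcont⟩ := (hpl 0).exists_forall_mem_closedBall_eq_hasDerivWithinAt_continuousOn
  have hr' : (0 : ℝ) < r := hr
  have hmem : Metric.closedBall p (r : ℝ) ×ˢ Icc (0 - ε) (0 + ε) ∈ 𝓝 (p, (0 : ℝ)) :=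
    prod_mem_nhds (Metric.closedBall_mem_nhds p hr') (Icc_mem_nhds (by linarith) (by linarith))
  have hα0 : α (p, 0) = p := (hα p (Metric.mem_closedBall_self hr'.le)).1
  have hev : ∀ᶠ z in 𝓝 (p, (0 : ℝ)), α z ∈ Ω :=
    (hcont.continuousAt hmem).eventually_mem (by rw [hα0]; exact hΩ.mem_nhds hp)
  obtain ⟨δ, hδ, hball⟩ := Metric.eventually_nhds_iff_ball.1 hev
  refine ⟨min r δ, lt_min hr' hδ, min ε δ, lt_min hε hδ, fun x hx => ?_⟩
  have hx1 : x ∈ Metric.closedBall p (r : ℝ) :=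
    Metric.ball_subset_closedBall (Metric.ball_subset_ball (min_le_left _ _) hx)
  refine ⟨fun t => α (x, t), (hα x hx1).1, fun t ht => ⟨?_, ?_⟩⟩
  · apply hball
    rw [← ball_prod_same]
    refine ⟨Metric.ball_subset_ball (min_le_right _ _) hx, ?_⟩
    rw [Metric.mem_ball, Real.dist_eq, sub_zero, abs_lt]
    exact ⟨by linarith [ht.1, min_le_right ε δ], by linarith [ht.2, min_le_right ε δ]⟩
  · have h1 : 0 - ε < t := by linarith [ht.1, min_le_left ε δ]
    have h2 : t < 0 + ε := by linarith [ht.2, min_le_left ε δ]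
    exact ((hα x hx1).2 t ⟨h1.le, h2.le⟩).hasDerivAt (Icc_mem_nhds h1 h2)

theorem contDiffOn_of_integralCurve {Ω : Set E2} {V : E2 → E2} (hV : ContDiffOn ℝ ∞ V Ω)
    {c : ℝ → E2} {ε : ℝ} (hc : ∀ t ∈ Ioo (-ε) ε, c t ∈ Ω ∧ HasDerivAt c (V (c t)) t) :
    ContDiffOn ℝ ∞ c (Ioo (-ε) ε) := by
  intro t ht
  obtain ⟨a, ha, hat⟩ := exists_between ht.1
  obtain ⟨b, htb, hb⟩ := exists_between ht.2
  have hsub : Icc a b ⊆ Ioo (-ε) ε := Icc_subset_Ioo ha hb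
  have := ODE.contDiffOn_enat_Icc_of_hasDerivWithinAt (n := ⊤) (f := fun _ => V) (α := c) (u := Ω)
    (tmin := a) (tmax := b) (hV.comp contDiffOn_snd fun z hz => hz.2)
    (fun s hs => (hc s (hsub hs)).2.hasDerivWithinAt) (fun s hs => (hc s (hsub hs)).1)
  exact (this.contDiffAt (Icc_mem_nhds hat htb)).contDiffWithinAt

/-- Near a point where two vector fields are transverse, every integral curve of the first meets
every integral curve of the second. The map `(t, s) ↦ c₁ t - c₂ s` is close to the linear isomorphism
`(t, s) ↦ t • V₁ p - s • V₂ p`, so that it takes the value `0`. -/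
theorem exists_crossing {Ω : Set E2} (hΩ : IsOpen Ω) {V₁ V₂ : E2 → E2}
    (hV₁ : ContDiffOn ℝ ∞ V₁ Ω) (hV₂ : ContDiffOn ℝ ∞ V₂ Ω) {p : E2} (hp : p ∈ Ω)
    (hind : LinearIndependent ℝ ![V₁ p, V₂ p]) :
    ∃ r > 0, ∃ ε > 0, ∀ q ∈ Metric.ball p r, ∀ x ∈ Metric.ball p r, ∃ c₁ c₂ : ℝ → E2,
      c₁ 0 = q ∧ c₂ 0 = x ∧
      (∀ t ∈ Ioo (-ε) ε, c₁ t ∈ Ω ∧ HasDerivAt c₁ (V₁ (c₁ t)) t) ∧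
      (∀ t ∈ Ioo (-ε) ε, c₂ t ∈ Ω ∧ HasDerivAt c₂ (V₂ (c₂ t)) t) ∧
      ∃ t ∈ Ioo (-ε) ε, ∃ s ∈ Ioo (-ε) ε, c₁ t = c₂ s := by
  have hinj : Function.Injective
      ((LinearMap.toSpanSingleton ℝ E2 (V₁ p)).coprod
        (-LinearMap.toSpanSingleton ℝ E2 (V₂ p))) := by
    rw [← LinearMap.ker_eq_bot, LinearMap.ker_eq_bot']
    rintro ⟨t, s⟩ h
    rw [LinearIndependent.pair_iff] at hind
    have := hind t (-s) (by simpa using h)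
    simp only [neg_eq_zero] at this
    exact Prod.ext this.1 this.2
  let A : (ℝ × ℝ) ≃L[ℝ] E2 :=
    (LinearEquiv.ofInjectiveOfFinrankEq _ hinj (by simp)).toContinuousLinearEquiv
  have hA : ∀ t s, A (t, s) = t • V₁ p - s • V₂ p := by
    intro t s
    change t • V₁ p + -(s • V₂ p) = _
    rw [sub_eq_add_neg]
  set K : ℝ := (‖(A.symm : E2 →L[ℝ] ℝ × ℝ)‖₊ : ℝ)⁻¹ with hK
  have hKpos : 0 < K := inv_pos.2 (by exact_mod_cast A.nnnorm_symm_pos)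
  set c : NNReal := ⟨K / 2, by positivity⟩ with hcdef
  have hcont : ∀ V : E2 → E2, ContDiffOn ℝ ∞ V Ω →
      IsOpen (Ω ∩ (fun y => V y - V p) ⁻¹' Metric.ball 0 (K / 4)) := fun V hV =>
    (hV.continuousOn.sub continuousOn_const).isOpen_inter_preimage hΩ Metric.isOpen_ball
  have hpm : ∀ V : E2 → E2, p ∈ Ω ∩ (fun y => V y - V p) ⁻¹' Metric.ball 0 (K / 4) := fun V =>
    ⟨hp, by simp; positivity⟩
  obtain ⟨r₁, hr₁, ε₁, hε₁, H₁⟩ := exists_integralCurves (hcont V₁ hV₁)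
    (hV₁.mono inter_subset_left) (hpm V₁)
  obtain ⟨r₂, hr₂, ε₂, hε₂, H₂⟩ := exists_integralCurves (hcont V₂ hV₂)
    (hV₂.mono inter_subset_left) (hpm V₂)
  set ε := min ε₁ ε₂ with hεdef
  have hε : 0 < ε := lt_min hε₁ hε₂
  refine ⟨min (min r₁ r₂) (K * ε / 8), by positivity, ε, hε, fun q hq x hx => ?_⟩
  obtain ⟨c₁, hc₁0, hc₁⟩ := H₁ q (Metric.ball_subset_ball
    ((min_le_left _ _).trans (min_le_left _ _)) hq)
  obtain ⟨c₂, hc₂0, hc₂⟩ := H₂ x (Metric.ball_subset_ball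
    ((min_le_left _ _).trans (min_le_right _ _)) hx)
  have hsub₁ : Ioo (-ε) ε ⊆ Ioo (-ε₁) ε₁ :=
    Ioo_subset_Ioo (neg_le_neg (min_le_left _ _)) (min_le_left _ _)
  have hsub₂ : Ioo (-ε) ε ⊆ Ioo (-ε₂) ε₂ :=
    Ioo_subset_Ioo (neg_le_neg (min_le_right _ _)) (min_le_right _ _)
  refine ⟨c₁, c₂, hc₁0, hc₂0, fun t ht => ⟨(hc₁ t (hsub₁ ht)).1.1, (hc₁ t (hsub₁ ht)).2⟩,
    fun t ht => ⟨(hc₂ t (hsub₂ ht)).1.1, (hc₂ t (hsub₂ ht)).2⟩, ?_⟩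
  have lip : ∀ (V : E2 → E2) (γ : ℝ → E2), (∀ t ∈ Ioo (-ε) ε,
      γ t ∈ Ω ∩ (fun y => V y - V p) ⁻¹' Metric.ball 0 (K / 4) ∧ HasDerivAt γ (V (γ t)) t) →
      ∀ t ∈ Ioo (-ε) ε, ∀ s ∈ Ioo (-ε) ε,
        ‖(γ t - t • V p) - (γ s - s • V p)‖ ≤ K / 4 * |t - s| := by
    intro V γ hγ t ht s hs
    rw [← Real.norm_eq_abs]
    refine Convex.norm_image_sub_le_of_norm_hasDerivWithin_le (s := Ioo (-ε) ε)
      (f := fun t => γ t - t • V p)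
      (f' := fun t => V (γ t) - (1 : ℝ) • V p) (fun u hu => ?_) (fun u hu => ?_)
      (convex_Ioo _ _) hs ht
    · exact ((hγ u hu).2.sub ((hasDerivAt_id u).smul_const (V p))).hasDerivWithinAt
    · have := (hγ u hu).1.2
      simp only [mem_preimage, Metric.mem_ball, dist_zero_right] at this
      rw [one_smul]; exact this.le
  have lip₁ := lip V₁ c₁ fun t ht => hc₁ t (hsub₁ ht)
  have lip₂ := lip V₂ c₂ fun t ht => hc₂ t (hsub₂ ht)
  have happrox : ApproximatesLinearOn (fun z : ℝ × ℝ => c₁ z.1 - c₂ z.2) (A : ℝ × ℝ →L[ℝ] E2)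
      (Ioo (-ε) ε ×ˢ Ioo (-ε) ε) c := by
    rintro ⟨t, s⟩ ⟨ht, hs⟩ ⟨t', s'⟩ ⟨ht', hs'⟩
    have e : c₁ t - c₂ s - (c₁ t' - c₂ s') - (A : ℝ × ℝ →L[ℝ] E2) ((t, s) - (t', s')) =
        ((c₁ t - t • V₁ p) - (c₁ t' - t' • V₁ p)) - ((c₂ s - s • V₂ p) - (c₂ s' - s' • V₂ p)) := by
      have : (A : ℝ × ℝ →L[ℝ] E2) ((t, s) - (t', s')) = (t - t') • V₁ p - (s - s') • V₂ p := hA _ _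
      rw [this]; module
    have n1 : |t - t'| ≤ ‖((t, s) - (t', s') : ℝ × ℝ)‖ := norm_fst_le ((t, s) - (t', s') : ℝ × ℝ)
    have n2 : |s - s'| ≤ ‖((t, s) - (t', s') : ℝ × ℝ)‖ := norm_snd_le ((t, s) - (t', s') : ℝ × ℝ)
    dsimp only
    rw [e]
    refine (norm_sub_le _ _).trans ?_
    have l1 := lip₁ t ht t' ht'
    have l2 := lip₂ s hs s' hs'
    have hcK : (c : ℝ) = K / 2 := rfl
    rw [hcK]
    have := mul_le_mul_of_nonneg_left n1 (show 0 ≤ K / 4 by positivity)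
    have := mul_le_mul_of_nonneg_left n2 (show 0 ≤ K / 4 by positivity)
    linarith
  have hball : Metric.closedBall ((0 : ℝ), (0 : ℝ)) (ε / 2) ⊆ Ioo (-ε) ε ×ˢ Ioo (-ε) ε := by
    rw [← closedBall_prod_same]
    refine prod_mono ?_ ?_ <;>
    · rw [Real.closedBall_eq_Icc]
      exact Icc_subset_Ioo (by linarith) (by linarith)
  have hsurj := happrox.surjOn_closedBall_of_nonlinearRightInverse A.toNonlinearRightInverse
    (by positivity : 0 ≤ ε / 2) hball
  have h0 : (0 : E2) ∈ Metric.closedBall (c₁ (0, 0).1 - c₂ ((0 : ℝ), (0 : ℝ)).2)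
      (((A.toNonlinearRightInverse.nnnorm : ℝ)⁻¹ - c) * (ε / 2)) := by
    change (0 : E2) ∈ Metric.closedBall (c₁ 0 - c₂ 0) ((K - K / 2) * (ε / 2))
    rw [hc₁0, hc₂0, Metric.mem_closedBall, dist_zero_left, ← dist_eq_norm]
    have d1 : dist q p < K * ε / 8 := lt_of_lt_of_le hq (min_le_right _ _)
    have d2 : dist x p < K * ε / 8 := lt_of_lt_of_le hx (min_le_right _ _)
    have := dist_triangle_right q x p
    linarith
  obtain ⟨⟨t, s⟩, hts, h⟩ := hsurj h0
  exact ⟨t, (hball hts).1, s, (hball hts).2, sub_eq_zero.1 h⟩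

end IntegralCurves

/-! ### Flat surfaces and their rulings -/

section Flat

variable {Ω : Set E2} {g N : E2 → E3} {V V₁ V₂ : E2 → E2} {m m₁ m₂ : E2 → E3} {x : E2} {ε : ℝ}

/-- A function whose derivative along `V` vanishes is constant along the integral curves of `V`. -/
theorem eq_of_fderiv_eq_zero_of_integralCurve {F : Type*} [NormedAddCommGroup F] [NormedSpace ℝ F]
    {G : E2 → F} (hG : ∀ y ∈ Ω, DifferentiableAt ℝ G y) {c : ℝ → E2}
    (hc : ∀ t ∈ Ioo (-ε) ε, c t ∈ Ω ∧ HasDerivAt c (V (c t)) t)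
    (h : ∀ t ∈ Ioo (-ε) ε, fderiv ℝ G (c t) (V (c t)) = 0) {s t : ℝ} (hs : s ∈ Ioo (-ε) ε)
    (ht : t ∈ Ioo (-ε) ε) : G (c s) = G (c t) := by
  have hd : ∀ u ∈ Ioo (-ε) ε, HasDerivAt (G ∘ c) 0 u := fun u hu => by
    have := (hG _ (hc u hu).1).hasFDerivAt.comp_hasDerivAt u (hc u hu).2
    rwa [h u hu] at this
  exact isOpen_Ioo.is_const_of_deriv_eq_zero (f := G ∘ c) isPreconnected_Ioo
    (fun u hu => (hd u hu).differentiableAt.differentiableWithinAt)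
    (fun u hu => (hd u hu).deriv) hs ht

theorem continuousOn_fderiv_normal (hS : IsParamSurface Ω g N) : ContinuousOn (fderiv ℝ N) Ω :=
  fun _ hy => ((hS.contDiffAt_normal hy).fderiv_right (m := ∞)
    (by simp)).continuousAt.continuousWithinAt

theorem isOpen_fderiv_normal_ne_zero (hS : IsParamSurface Ω g N) :
    IsOpen (Ω ∩ fderiv ℝ N ⁻¹' {A | A ≠ 0}) :=
  (continuousOn_fderiv_normal hS).isOpen_inter_preimage hS.isOpen isOpen_ne

theorem fderiv_normal_ne_zero_of_normalCurvature
    (h : normalCurvature g N V x ≠ 0) : fderiv ℝ N x ≠ 0 := by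
  intro h0
  apply h
  simp [normalCurvature, h0]

/-- A leaf of the first foliation that passes through a point at which the second principal
curvature does not vanish is a straight line, orthogonal to the second foliation. -/
theorem straight_leaf (hS : IsParamSurface Ω g N) (h₁ : IsPlanarField Ω g N V₁ m₁)
    (h₂ : IsPlanarField Ω g N V₂ m₂)
    (horth : ∀ y ∈ Ω, fderiv ℝ N y ≠ 0 → cosAngle g V₁ V₂ y = 0) {c : ℝ → E2}
    (hc : ∀ t ∈ Ioo (-ε) ε, c t ∈ Ω ∧ HasDerivAt c (V₁ (c t)) t) (hε : 0 < ε)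
    (hk : normalCurvature g N V₂ (c 0) ≠ 0) {t : ℝ} (ht : t ∈ Ioo (-ε) ε) :
    fderiv ℝ g (c t) (V₁ (c t)) = fderiv ℝ g (c 0) (V₁ (c 0)) ∧ cosAngle g V₁ V₂ (c t) = 0 := by
  have h0 : (0 : ℝ) ∈ Ioo (-ε) ε := ⟨by linarith, hε⟩
  set A := Ω ∩ fderiv ℝ N ⁻¹' {A | A ≠ 0}
  have hA : IsOpen A := isOpen_fderiv_normal_ne_zero hS
  have hAΩ : A ⊆ Ω := inter_subset_left
  have horthA : ∀ y ∈ A, inner ℝ (fderiv ℝ g y (V₁ y)) (fderiv ℝ g y (V₂ y)) = 0 :=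
    fun y hy => horth y hy.1 hy.2
  have hSA := hS.mono hA hAΩ
  have hkd : ∀ y ∈ Ω, DifferentiableAt ℝ (normalCurvature g N V₂) y := fun y hy =>
    (h₂.contDiffAt_normalCurvature hS hy).differentiableAt (by simp)
  -- The square of the curvature has zero derivative along the whole leaf: where the curvature
  -- vanishes this is trivial, and elsewhere the foliations are orthogonal. So it cannot reach zero.
  have hk2 : ∀ s ∈ Ioo (-ε) ε, normalCurvature g N V₂ (c s) ≠ 0 := by
    intro s hs h
    have e := eq_of_fderiv_eq_zero_of_integralCurve (G := fun y => normalCurvature g N V₂ y ^ 2)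
      (fun y hy => (hkd y hy).pow 2) hc (fun u hu => by
        rw [fderiv_fun_pow 2 (hkd _ (hc u hu).1)]
        by_cases hz : normalCurvature g N V₂ (c u) = 0
        · simp [hz]
        · have := fderiv_normalCurvature_of_orthogonal hSA (h₁.mono hAΩ) (h₂.mono hAΩ) horthA
            (x := c u) ⟨(hc u hu).1, fderiv_normal_ne_zero_of_normalCurvature hz⟩
          simp [this]) hs h0
    simp only [h] at e
    exact hk (by simpa using e.symm)
  have hmem : ∀ s ∈ Ioo (-ε) ε, c s ∈ A := fun s hs =>
    ⟨(hc s hs).1, fderiv_normal_ne_zero_of_normalCurvature (hk2 s hs)⟩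
  refine ⟨?_, horthA _ (hmem t ht)⟩
  refine eq_of_fderiv_eq_zero_of_integralCurve (G := fun y => fderiv ℝ g y (V₁ y))
    (fun y hy => (h₁.contDiffAt_dir hS hy).differentiableAt (by simp)) hc (fun u hu => ?_) ht h0
  rw [h₁.fderiv_dir hS (hc u hu).1]
  have := normalCurvature_mul_of_orthogonal hSA (h₁.mono hAΩ) (h₂.mono hAΩ) horthA (hmem u hu)
  rw [(mul_eq_zero.1 this).resolve_right (hk2 u hu), zero_smul]

/-- If a leaf of the first foliation is a ruling, then its direction is tangent to the surface at all
points of the leaves of the second foliation that meet it: it is normal to the planes of those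
leaves. -/
theorem inner_normal_eq_zero_of_crossing (hS : IsParamSurface Ω g N)
    (h₁ : IsPlanarField Ω g N V₁ m₁) (h₂ : IsPlanarField Ω g N V₂ m₂)
    (horth : ∀ y ∈ Ω, fderiv ℝ N y ≠ 0 → cosAngle g V₁ V₂ y = 0) {c₁ c₂ : ℝ → E2}
    (hc₁ : ∀ t ∈ Ioo (-ε) ε, c₁ t ∈ Ω ∧ HasDerivAt c₁ (V₁ (c₁ t)) t)
    (hc₂ : ∀ t ∈ Ioo (-ε) ε, c₂ t ∈ Ω ∧ HasDerivAt c₂ (V₂ (c₂ t)) t)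
    (hk : normalCurvature g N V₂ (c₁ 0) ≠ 0) {t s : ℝ} (ht : t ∈ Ioo (-ε) ε)
    (hs : s ∈ Ioo (-ε) ε) (hts : c₁ t = c₂ s) :
    inner ℝ (fderiv ℝ g (c₁ 0) (V₁ (c₁ 0))) (N (c₂ 0)) = 0 := by
  have hε : 0 < ε := by linarith [ht.1, ht.2]
  obtain ⟨he, ho⟩ := straight_leaf hS h₁ h₂ horth hc₁ hε hk ht
  have hmem := (hc₁ t ht).1
  have hm : m₂ (c₂ 0) = m₂ (c₁ t) := by
    rw [hts]
    exact eq_of_fderiv_eq_zero_of_integralCurve (G := m₂)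
      (fun y hy => (h₂.contDiffAt_conormal hS hy).differentiableAt (by simp)) hc₂
      (fun u hu => h₂.fderiv_conormal _ (hc₂ u hu).1) ⟨by linarith, hε⟩ hs
  have e := h₂.expand hS hmem (fderiv ℝ g (c₁ t) (V₁ (c₁ t)))
  rw [hS.inner_normal _ hmem] at e
  change inner ℝ (fderiv ℝ g (c₁ t) (V₁ (c₁ t))) (fderiv ℝ g (c₁ t) (V₂ (c₁ t))) = 0 at ho
  rw [ho, zero_smul, zero_smul, zero_add, add_zero, he, ← hm] at e
  rw [e, inner_smul_left, h₂.inner_conormal_normal _ (hc₂ 0 ⟨by linarith, hε⟩).1, mul_zero]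

/-- Where the Gauss map has nowhere an injective differential, some constant vector is tangent to
the surface near each point. -/
theorem exists_const_tangent (hS : IsParamSurface Ω g N)
    (h₁ : IsPlanarField Ω g N V₁ m₁) (h₂ : IsPlanarField Ω g N V₂ m₂)
    (hD : ∀ W ⊆ Ω, IsOpen W → W.Nonempty → ∃ y ∈ W, cosAngle g V₁ V₂ y ^ 2 ≠ 1)
    (hflat : ∀ y ∈ Ω, ¬ Function.Injective (fderiv ℝ N y)) (hx : x ∈ Ω) :
    ∃ e : E3, ‖e‖ = 1 ∧ ∀ᶠ y in 𝓝 x, inner ℝ e (N y) = 0 := by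
  set A := Ω ∩ fderiv ℝ N ⁻¹' {A | A ≠ 0}
  have hA : IsOpen A := isOpen_fderiv_normal_ne_zero hS
  have hcos := continuousOn_cosAngle hS h₁ h₂
  have horth : ∀ y ∈ Ω, fderiv ℝ N y ≠ 0 → cosAngle g V₁ V₂ y = 0 := by
    intro y hy hne
    by_contra h0
    have hW : IsOpen (A ∩ cosAngle g V₁ V₂ ⁻¹' {c | c ≠ 0}) :=
      (hcos.mono inter_subset_left).isOpen_inter_preimage hA isOpen_ne
    obtain ⟨z, ⟨⟨hzΩ, hzne⟩, hz0⟩, hzc⟩ := hD _ (fun z hz => hz.1.1) hW ⟨y, ⟨hy, hne⟩, h0⟩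
    have e := fderiv_normal_eq_of_oblique hS h₁ h₂ hzΩ hzc hz0
    have hk : normalCurvature g N V₁ z ≠ 0 := by
      intro h
      refine hzne (ContinuousLinearMap.ext fun v => ?_)
      rw [e, h, neg_zero, zero_smul, zero_apply]
    apply hflat z hzΩ
    intro u v huv
    rw [e, e] at huv
    exact hS.injective z hzΩ (smul_right_injective E3 (neg_ne_zero.2 hk) huv)
  by_cases hcl : x ∈ closure A
  · -- The foliations are transverse at `x`, so that the leaves near `x` cross each other.
    have hcx : cosAngle g V₁ V₂ x = 0 := by
      by_contra h0
      have hW := hcos.isOpen_inter_preimage hS.isOpen (isOpen_ne (x := 0))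
      obtain ⟨y, ⟨hyΩ, hy0⟩, hyA⟩ := mem_closure_iff.1 hcl _ hW ⟨hx, h0⟩
      exact hy0 (horth y hyΩ hyA.2)
    have hc1 : cosAngle g V₁ V₂ x ^ 2 ≠ 1 := by rw [hcx]; norm_num
    obtain ⟨r, hr, ε, hε, H⟩ := exists_crossing hS.isOpen h₁.smooth h₂.smooth hx
      (linearIndependent_of_cosAngle h₁ h₂ hx hc1)
    obtain ⟨r', hr', ε', hε', H'⟩ := exists_crossing hS.isOpen h₂.smooth h₁.smooth hx
      (linearIndependent_of_cosAngle h₂ h₁ hx (by rwa [cosAngle_comm]))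
    obtain ⟨q, hqr, hqA⟩ := mem_closure_iff.1 hcl _ Metric.isOpen_ball
      (Metric.mem_ball_self (lt_min hr hr'))
    have hqr1 := Metric.ball_subset_ball (min_le_left r r') hqr
    have hqr2 := Metric.ball_subset_ball (min_le_right r r') hqr
    by_cases hk : normalCurvature g N V₂ q = 0
    · have hk₁ : normalCurvature g N V₁ q ≠ 0 := by
        intro hk₁
        have hq0 := horth q hqA.1 hqA.2
        refine hqA.2 (ContinuousLinearMap.eq_of_linearIndependent_pair
          (linearIndependent_of_cosAngle h₁ h₂ hqA.1 (by rw [hq0]; norm_num)) ?_ ?_)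
        · rw [h₁.fderiv_normal hS hqA.1, hk₁]; simp
        · rw [h₂.fderiv_normal hS hqA.1, hk]; simp
      refine ⟨fderiv ℝ g q (V₂ q), h₂.norm_dir q hqA.1,
        Filter.eventually_of_mem (Metric.ball_mem_nhds x hr') fun y hy => ?_⟩
      obtain ⟨c₁, c₂, rfl, rfl, hc₁, hc₂, t, ht, s, hs, hts⟩ := H' q hqr2 y hy
      exact inner_normal_eq_zero_of_crossing hS h₂ h₁
        (fun y hy hn => by rw [cosAngle_comm]; exact horth y hy hn) hc₁ hc₂ hk₁ ht hs hts
    · refine ⟨fderiv ℝ g q (V₁ q), h₁.norm_dir q hqA.1,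
        Filter.eventually_of_mem (Metric.ball_mem_nhds x hr) fun y hy => ?_⟩
      obtain ⟨c₁, c₂, rfl, rfl, hc₁, hc₂, t, ht, s, hs, hts⟩ := H q hqr1 y hy
      exact inner_normal_eq_zero_of_crossing hS h₁ h₂ horth hc₁ hc₂ hk ht hs hts
  · -- Near `x` the surface is planar.
    obtain ⟨r, hr, hball⟩ := Metric.isOpen_iff.1 (hS.isOpen.inter isClosed_closure.isOpen_compl)
      x ⟨hx, hcl⟩
    refine ⟨fderiv ℝ g x (V₁ x), h₁.norm_dir x hx,
      Filter.eventually_of_mem (Metric.ball_mem_nhds x hr) fun y hy => ?_⟩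
    have : N y = N x := Metric.isOpen_ball.is_const_of_fderiv_eq_zero (𝕜 := ℝ)
      (convex_ball x r).isPreconnected
      (fun z hz => ((hS.contDiffAt_normal (hball hz).1).differentiableAt
        (by simp)).differentiableWithinAt)
      (fun z hz => by
        by_contra hne
        exact (hball hz).2 (subset_closure ⟨(hball hz).1, hne⟩)) hy (Metric.mem_ball_self hr)
    rw [this, hS.inner_normal x hx]

end Flat

/-! ### The cross product, cylinders and spheres -/

section Cross

/-- The cross product in Euclidean three-space. -/
noncomputable def cross (x y : E3) : E3 :=
  WithLp.toLp 2 (crossProduct (WithLp.ofLp x) (WithLp.ofLp y))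

theorem inner_cross_left (x y : E3) : inner ℝ (cross x y) x = 0 := by
  simp [cross, PiLp.inner_apply, Fin.sum_univ_three, cross_apply]
  ring

theorem inner_cross_right (x y : E3) : inner ℝ (cross x y) y = 0 := by
  simp [cross, PiLp.inner_apply, Fin.sum_univ_three, cross_apply]
  ring

theorem norm_cross_sq (x y : E3) :
    ‖cross x y‖ ^ 2 = ‖x‖ ^ 2 * ‖y‖ ^ 2 - inner ℝ x y ^ 2 := by
  simp only [EuclideanSpace.real_norm_sq_eq]
  simp [cross, PiLp.inner_apply, Fin.sum_univ_three, cross_apply]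
  ring

theorem norm_cross_of_orthonormal {x y : E3} (hx : ‖x‖ = 1) (hy : ‖y‖ = 1) (h : inner ℝ x y = 0) :
    ‖cross x y‖ = 1 := by
  have := norm_cross_sq x y
  rw [hx, hy, h] at this
  nlinarith [norm_nonneg (cross x y)]

theorem cross_ne_zero {x y : E3} (h : LinearIndependent ℝ ![x, y]) : cross x y ≠ 0 := by
  intro h0
  have h1 := norm_cross_sq x y
  rw [h0] at h1
  have h2 : |inner ℝ x y| = ‖x‖ * ‖y‖ := by
    rw [← abs_of_nonneg (mul_nonneg (norm_nonneg x) (norm_nonneg y)), ← sq_eq_sq_iff_abs_eq_abs]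
    simp at h1
    linarith
  rw [LinearIndependent.pair_iff] at h
  have hx : x ≠ 0 := by
    rintro rfl
    simpa using h 1 0 (by simp)
  obtain ⟨-, r, -, hr⟩ := (abs_real_inner_div_norm_mul_norm_eq_one_iff x y).1 (by
    rw [abs_div, h2, abs_of_nonneg (mul_nonneg (norm_nonneg x) (norm_nonneg y)), div_self]
    have hy : y ≠ 0 := by
      rintro rfl
      simpa using h 0 1 (by simp)
    exact mul_ne_zero (norm_ne_zero_iff.2 hx) (norm_ne_zero_iff.2 hy))
  simpa using (h r (-1) (by rw [hr]; simp)).2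

theorem ContDiffOn.cross {G H : E2 → E3} {s : Set E2} (hG : ContDiffOn ℝ ∞ G s)
    (hH : ContDiffOn ℝ ∞ H s) : ContDiffOn ℝ ∞ (fun x => cross (G x) (H x)) s := by
  rw [contDiffOn_euclidean] at hG hH ⊢
  intro i
  fin_cases i
  · exact ((hG 1).mul (hH 2)).sub ((hG 2).mul (hH 1))
  · exact ((hG 2).mul (hH 0)).sub ((hG 0).mul (hH 2))
  · exact ((hG 0).mul (hH 1)).sub ((hG 1).mul (hH 0))

end Cross

section Graph

variable {Ω : Set E2} {g N : E2 → E3} {V₁ V₂ : E2 → E2} {m₁ m₂ : E2 → E3} {x p : E2}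

/-- The image of the differential is the orthogonal complement of the normal. -/
theorem IsParamSurface.exists_fderiv_eq (hS : IsParamSurface Ω g N) (hx : x ∈ Ω) {w : E3}
    (hw : inner ℝ w (N x) = 0) : ∃ v, fderiv ℝ g x v = w := by
  have hle : LinearMap.range (fderiv ℝ g x).toLinearMap ≤ (ℝ ∙ N x)ᗮ := by
    rintro _ ⟨v, rfl⟩
    rw [Submodule.mem_orthogonal_singleton_iff_inner_left]
    exact hS.inner_normal x hx v
  have hN : N x ≠ 0 := fun h => by simpa [h] using hS.norm_normal x hx
  have h1 : Module.finrank ℝ (LinearMap.range (fderiv ℝ g x).toLinearMap) = 2 := by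
    rw [LinearMap.finrank_range_of_inj (hS.injective x hx)]; simp
  have h2 : Module.finrank ℝ (ℝ ∙ N x)ᗮ = 2 := by
    have : Fact (Module.finrank ℝ E3 = 2 + 1) := ⟨by simp⟩
    exact Submodule.finrank_orthogonal_span_singleton hN
  have h3 := Submodule.eq_of_le_of_finrank_eq hle (h1.trans h2.symm)
  have h4 : w ∈ LinearMap.range (fderiv ℝ g x).toLinearMap := by
    rw [h3, Submodule.mem_orthogonal_singleton_iff_inner_left]
    exact hw
  exact h4

/-- Near each of its points, a surface is a graph over its tangent plane: the coordinates with
respect to an orthonormal frame `a`, `b` of the tangent plane at `p` are local coordinates. -/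
theorem exists_graph_coordinates (hS : IsParamSurface Ω g N) {a b : E3} (ha : ‖a‖ = 1)
    (hb : ‖b‖ = 1) (hab : inner ℝ a b = 0) (hp : p ∈ Ω) (han : inner ℝ a (N p) = 0)
    (hbn : inner ℝ b (N p) = 0) {s : Set E2} (hs : s ∈ 𝓝 p) :
    ∃ Φ : OpenPartialHomeomorph E2 (ℝ × ℝ), p ∈ Φ.source ∧ Φ.source ⊆ Ω ∩ s ∧
      (∀ x, Φ x = (inner ℝ (g x) a, inner ℝ (g x) b)) ∧
      ContDiffOn ℝ ∞ Φ.symm Φ.target ∧ ∀ x ∈ Φ.source, inner ℝ (N x) (N p) ≠ 0 := by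
  set φ : E2 → ℝ × ℝ := fun x => (inner ℝ (g x) a, inner ℝ (g x) b) with hφ
  have hφs : ∀ x ∈ Ω, ContDiffAt ℝ ∞ φ x := fun x hx =>
    ((hS.contDiffAt hx).inner ℝ contDiffAt_const).prodMk
      ((hS.contDiffAt hx).inner ℝ contDiffAt_const)
  have hφd : ∀ x ∈ Ω, ∀ v, fderiv ℝ φ x v =
      (inner ℝ (fderiv ℝ g x v) a, inner ℝ (fderiv ℝ g x v) b) := by
    intro x hx v
    have hg := (hS.contDiffAt hx).differentiableAt (by simp : (∞ : WithTop ℕ∞) ≠ 0)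
    have d : ∀ w : E3, DifferentiableAt ℝ (fun x => inner ℝ (g x) w) x := fun w =>
      hg.inner ℝ (differentiableAt_const w)
    rw [hφ, DifferentiableAt.fderiv_prodMk (d a) (d b)]
    simp [fderiv_inner_apply ℝ hg (differentiableAt_const _)]
  have hequiv : ∀ x ∈ Ω, inner ℝ (N x) (N p) ≠ 0 →
      ∃ A : E2 ≃L[ℝ] ℝ × ℝ, HasFDerivAt φ (A : E2 →L[ℝ] ℝ × ℝ) x := by
    intro x hx hne
    have hinj : Function.Injective (fderiv ℝ φ x).toLinearMap := by
      rw [← LinearMap.ker_eq_bot, LinearMap.ker_eq_bot']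
      intro v hv
      have hv' := (hφd x hx v).symm.trans hv
      have e := eq_sum_inner_of_orthonormal ha hb (hS.norm_normal p hp) hab han hbn (fderiv ℝ g x v)
      have hva : inner ℝ (fderiv ℝ g x v) a = 0 := congrArg Prod.fst hv'
      have hvb : inner ℝ (fderiv ℝ g x v) b = 0 := congrArg Prod.snd hv'
      rw [hva, hvb, zero_smul, zero_smul, zero_add, zero_add] at e
      have e2 := hS.inner_normal x hx v
      rw [e, inner_smul_left, real_inner_comm (N x)] at e2
      have e3 : inner ℝ (fderiv ℝ g x v) (N p) = 0 :=
        (mul_eq_zero.1 e2).resolve_right hne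
      rw [e3, zero_smul] at e
      exact hS.injective x hx (by rw [e, map_zero])
    refine ⟨(LinearEquiv.ofInjectiveOfFinrankEq _ hinj (by simp)).toContinuousLinearEquiv, ?_⟩
    exact ((hφs x hx).differentiableAt (by simp)).hasFDerivAt
  have hpp : inner ℝ (N p) (N p) ≠ 0 := by
    rw [real_inner_self_eq_norm_sq, hS.norm_normal p hp]; norm_num
  obtain ⟨A, hA⟩ := hequiv p hp hpp
  set Φ₀ := (hφs p hp).toOpenPartialHomeomorph φ hA (by simp)
  set W := interior s ∩ (Ω ∩ (fun x => inner ℝ (N x) (N p)) ⁻¹' {c | c ≠ 0})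
  have hW : IsOpen W := isOpen_interior.inter
    ((hS.smooth_normal.continuousOn.inner continuousOn_const).isOpen_inter_preimage hS.isOpen
      isOpen_ne)
  set Φ := Φ₀.restrOpen W hW
  have hsrc : Φ.source = Φ₀.source ∩ W := Φ₀.restrOpen_source W hW
  have hpΦ : p ∈ Φ.source := by
    rw [hsrc]
    exact ⟨(hφs p hp).mem_toOpenPartialHomeomorph_source hA (by simp),
      mem_interior_iff_mem_nhds.2 hs, hp, hpp⟩
  refine ⟨Φ, hpΦ, fun x hx => ?_, fun x => rfl, fun z hz => ?_, fun x hx => ?_⟩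
  · rw [hsrc] at hx
    exact ⟨hx.2.2.1, interior_subset hx.2.1⟩
  · have hz' := Φ.map_target hz
    rw [hsrc] at hz'
    obtain ⟨A', hA'⟩ := hequiv _ hz'.2.2.1 hz'.2.2.2
    exact (Φ.contDiffAt_symm hz hA' (hφs _ hz'.2.2.1)).contDiffWithinAt
  · rw [hsrc] at hx
    exact hx.2.2.2

/-- A surface with a constant tangent vector is locally a cylinder over a plane curve. -/
theorem exists_cylinder (hS : IsParamSurface Ω g N) (hp : p ∈ Ω) {e : E3} (he : ‖e‖ = 1)
    (hev : ∀ᶠ y in 𝓝 p, inner ℝ e (N y) = 0) :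
    ∃ U ⊆ Ω, IsOpen U ∧ p ∈ U ∧ InjOn g U ∧
      ∃ C : Set E3, IsCylinderOverPlaneCurve C ∧ IsOpenSubsetOf (g '' U) C := by
  have hn := hS.norm_normal p hp
  have hen : inner ℝ e (N p) = 0 := hev.self_of_nhds
  set n := N p with hndef
  set a := cross e n
  have ha : ‖a‖ = 1 := norm_cross_of_orthonormal he hn hen
  have hae : inner ℝ a e = 0 := inner_cross_left e n
  have han : inner ℝ a n = 0 := inner_cross_right e n
  have hne : inner ℝ n e = 0 := by rw [real_inner_comm]; exact hen
  have hna : inner ℝ n a = 0 := by rw [real_inner_comm]; exact han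
  have haa : inner ℝ a a = (1 : ℝ) := by rw [real_inner_self_eq_norm_sq, ha]; norm_num
  have hee : inner ℝ e e = (1 : ℝ) := by rw [real_inner_self_eq_norm_sq, he]; norm_num
  obtain ⟨Φ, hpΦ, hΦΩ, hΦ, hΦs, hNn⟩ := exists_graph_coordinates hS ha he hae hp han hen hev
  obtain ⟨ε, hε, hball⟩ := Metric.isOpen_iff.1 Φ.open_target (Φ p) (Φ.map_source hpΦ)
  set u₀ := (Φ p).1
  set v₀ := (Φ p).2
  have hsq : Ioo (u₀ - ε) (u₀ + ε) ×ˢ Ioo (v₀ - ε) (v₀ + ε) ⊆ Φ.target := by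
    rw [← Real.ball_eq_Ioo, ← Real.ball_eq_Ioo, ball_prod_same]
    exact hball
  set Q := Ioo (u₀ - ε) (u₀ + ε) ×ˢ Ioo (v₀ - ε) (v₀ + ε) with hQ
  have hQo : IsOpen Q := isOpen_Ioo.prod isOpen_Ioo
  set G : ℝ × ℝ → E3 := fun z => g (Φ.symm z) with hG
  have hGs : ContDiffOn ℝ ∞ G Φ.target := hS.smooth.comp hΦs fun z hz =>
    (hΦΩ (Φ.map_target hz)).1
  set h : ℝ × ℝ → ℝ := fun z => inner ℝ (G z) n with hh
  have hhs : ContDiffOn ℝ ∞ h Φ.target := hGs.inner ℝ contDiffOn_const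
  have hGa : ∀ z ∈ Φ.target, inner ℝ (G z) a = z.1 := fun z hz => by
    have := congrArg Prod.fst (Φ.right_inv hz)
    rwa [hΦ] at this
  have hGe : ∀ z ∈ Φ.target, inner ℝ (G z) e = z.2 := fun z hz => by
    have := congrArg Prod.snd (Φ.right_inv hz)
    rwa [hΦ] at this
  have hGexp : ∀ z ∈ Φ.target, G z = z.1 • a + z.2 • e + h z • n := fun z hz => by
    have := eq_sum_inner_of_orthonormal ha he hn hae han hen (G z)
    rwa [hGa z hz, hGe z hz] at this
  -- The height over the tangent plane does not depend on the second coordinate.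
  have hdh : ∀ z ∈ Φ.target, fderiv ℝ h z (0, 1) = 0 := by
    intro z hz
    have htn := Φ.open_target.mem_nhds hz
    have hdG : DifferentiableAt ℝ G z := (hGs.contDiffAt htn).differentiableAt (by simp)
    set w := fderiv ℝ G z (0, 1) with hw
    have hwa : inner ℝ w a = 0 := by
      have e1 : (fun z => inner ℝ (G z) a) =ᶠ[𝓝 z] fun z => z.1 :=
        Filter.eventually_of_mem htn hGa
      have e2 := fderiv_inner_apply ℝ hdG (differentiableAt_const a) (0, 1)
      rw [e1.fderiv_eq, fderiv_fst] at e2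
      simpa using e2.symm
    have hwe : inner ℝ w e = 1 := by
      have e1 : (fun z => inner ℝ (G z) e) =ᶠ[𝓝 z] fun z => z.2 :=
        Filter.eventually_of_mem htn hGe
      have e2 := fderiv_inner_apply ℝ hdG (differentiableAt_const e) (0, 1)
      rw [e1.fderiv_eq, fderiv_snd] at e2
      simpa using e2.symm
    have hwn : inner ℝ w n = fderiv ℝ h z (0, 1) := by
      have e2 := fderiv_inner_apply ℝ hdG (differentiableAt_const n) (0, 1)
      rw [hh, e2]; simp [hw]
    set y := Φ.symm z
    have hy := hΦΩ (Φ.map_target hz)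
    have hwN : inner ℝ w (N y) = 0 := by
      have : fderiv ℝ G z = (fderiv ℝ g y).comp (fderiv ℝ Φ.symm z) :=
        fderiv_comp z ((hS.contDiffAt hy.1).differentiableAt (by simp))
          ((hΦs.contDiffAt htn).differentiableAt (by simp))
      rw [hw, this]
      exact hS.inner_normal y hy.1 _
    have e3 := eq_sum_inner_of_orthonormal ha he hn hae han hen w
    rw [hwa, hwe, zero_smul, one_smul, zero_add] at e3
    have hyN : inner ℝ e (N y) = 0 := hy.2
    rw [e3, inner_add_left, hyN, inner_smul_left, zero_add, real_inner_comm (N y)] at hwN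
    rw [← hwn]
    exact (mul_eq_zero.1 hwN).resolve_right (hNn y (Φ.map_target hz))
  have hconst : ∀ z ∈ Q, h z = h (z.1, v₀) := by
    rintro ⟨u, v⟩ ⟨hu, hv⟩
    dsimp only at hu hv
    refine isOpen_Ioo.is_const_of_deriv_eq_zero (𝕜 := ℝ) (f := fun t => h (u, t))
      (s := Ioo (v₀ - ε) (v₀ + ε))
      isPreconnected_Ioo ?_ ?_ hv ⟨by linarith, by linarith⟩
    all_goals
      intro t ht
      have hut : (u, t) ∈ Φ.target := hsq ⟨hu, ht⟩
      have hd : HasDerivAt (fun t => h (u, t)) (fderiv ℝ h (u, t) (0, 1)) t :=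
        ((hhs.contDiffAt (Φ.open_target.mem_nhds hut)).differentiableAt
          (by simp)).hasFDerivAt.comp_hasDerivAt (f := fun t => (u, t)) t
          ((hasDerivAt_const t u).prodMk (hasDerivAt_id t))
    · exact hd.differentiableAt.differentiableWithinAt
    · rw [hd.deriv, hdh _ hut]; rfl
  set I := Ioo (u₀ - ε) (u₀ + ε)
  set γ : ℝ → E3 := fun u => u • a + h (u, v₀) • n with hγ
  have hv₀ : v₀ ∈ Ioo (v₀ - ε) (v₀ + ε) := ⟨by linarith, by linarith⟩
  have hγs : ContDiffOn ℝ ∞ γ I := by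
    have : ContDiffOn ℝ ∞ (fun u : ℝ => h (u, v₀)) I :=
      hhs.comp (contDiffOn_id.prodMk contDiffOn_const) fun u hu => hsq ⟨hu, hv₀⟩
    exact (contDiffOn_id.smul contDiffOn_const).add (this.smul contDiffOn_const)
  have hγa : ∀ u, inner ℝ (γ u) a = u := fun u => by
    rw [hγ, inner_add_left, inner_smul_left, inner_smul_left, haa, hna]; simp
  have hγe : ∀ u, inner ℝ (γ u) e = 0 := fun u => by
    simp [hγ, inner_add_left, inner_smul_left, hae, hne]
  have hGγ : ∀ z ∈ Q, G z = γ z.1 + z.2 • e := fun z hz => by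
    rw [hGexp z (hsq hz), hconst z hz]; exact add_right_comm _ _ _
  refine ⟨Φ.source ∩ Φ ⁻¹' Q, fun x hx => (hΦΩ hx.1).1, Φ.isOpen_inter_preimage hQo,
    ⟨hpΦ, ⟨⟨by linarith, by linarith⟩, hv₀⟩⟩, ?_, {x | ∃ t ∈ I, ∃ s : ℝ, x = γ t + s • e}, ?_, ?_⟩
  · intro x hx y hy hxy
    exact Φ.injOn hx.1 hy.1 (by rw [hΦ, hΦ, hxy])
  · refine ⟨((ℝ ∙ e)ᗮ).toAffineSubspace, e, I, γ, ?_, he, ?_, isOpen_Ioo, ordConnected_Ioo,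
      ⟨u₀, by linarith, by linarith⟩, hγs, ?_, ?_, ?_, rfl⟩
    · rw [Submodule.toAffineSubspace_direction]
      have : Fact (Module.finrank ℝ E3 = 2 + 1) := ⟨by simp⟩
      exact Submodule.finrank_orthogonal_span_singleton fun h0 => by simp [h0] at he
    · rw [Submodule.toAffineSubspace_direction, Submodule.orthogonal_orthogonal]
      exact Submodule.mem_span_singleton_self e
    · intro t ht h0
      have hd : HasDerivAt γ (deriv γ t) t :=
        ((hγs.contDiffAt (isOpen_Ioo.mem_nhds ht)).differentiableAt (by simp)).hasDerivAt
      have h1 := hd.inner ℝ (hasDerivAt_const t a)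
      simp only [hγa, h0, inner_zero_left, inner_zero_right, add_zero] at h1
      exact one_ne_zero ((hasDerivAt_id t).unique h1)
    · intro t _ s _ hts
      rw [← hγa t, hts, hγa]
    · intro t _
      rw [Submodule.mem_toAffineSubspace, Submodule.mem_orthogonal_singleton_iff_inner_left]
      exact hγe t
  · refine ⟨(fun x => inner ℝ x e) ⁻¹' Ioo (v₀ - ε) (v₀ + ε),
      isOpen_Ioo.preimage (continuous_id.inner continuous_const), ?_⟩
    ext x
    constructor
    · rintro ⟨y, ⟨hy, hyQ⟩, rfl⟩
      have e1 := hGγ _ hyQ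
      simp only [hG, Φ.left_inv hy] at e1
      refine ⟨?_, (Φ y).1, hyQ.1, (Φ y).2, e1⟩
      have := hyQ.2
      rw [hΦ] at this
      exact this
    · rintro ⟨hx, t, ht, s, rfl⟩
      have hs : s ∈ Ioo (v₀ - ε) (v₀ + ε) := by
        simpa [inner_add_left, inner_smul_left, hγe, hee, mem_preimage, he] using hx
      have hz : (t, s) ∈ Q := ⟨ht, hs⟩
      refine ⟨Φ.symm (t, s), ⟨Φ.map_target (hsq hz), ?_⟩, ?_⟩
      · rw [mem_preimage, Φ.right_inv (hsq hz)]; exact hz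
      · exact hGγ _ hz

end Graph

section Sphere

variable {Ω : Set E2} {g N : E2 → E3} {V₁ V₂ : E2 → E2} {m₁ m₂ : E2 → E3} {x p : E2}
  {o : E3} {r : ℝ}

/-- Where a surface lies in a sphere, its normals pass through the center. -/
theorem sub_center_eq_smul_normal (hS : IsParamSurface Ω g N) (hx : x ∈ Ω)
    (h : ∀ᶠ y in 𝓝 x, ‖g y - o‖ = r) : g x - o = inner ℝ (g x - o) (N x) • N x := by
  have hd : DifferentiableAt ℝ (fun y => g y - o) x :=
    ((hS.contDiffAt hx).differentiableAt (by simp)).sub_const o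
  have hperp : ∀ v, inner ℝ (g x - o) (fderiv ℝ g x v) = 0 := by
    intro v
    have := inner_fderiv_add_inner_fderiv_eq_zero hd hd (c := r ^ 2)
      (h.mono fun y hy => by rw [real_inner_self_eq_norm_sq, hy]) v
    rw [fderiv_sub_const, real_inner_comm] at this
    linarith
  set w := g x - o - inner ℝ (g x - o) (N x) • N x with hw
  have hwN : inner ℝ w (N x) = 0 := by
    rw [hw, inner_sub_left, inner_smul_left, real_inner_self_eq_norm_sq, hS.norm_normal x hx]
    simp
  obtain ⟨v, hv⟩ := hS.exists_fderiv_eq hx hwN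
  have hww : inner ℝ w w = 0 := by
    nth_rewrite 1 [hw]
    rw [inner_sub_left, inner_smul_left, ← hv, hperp, real_inner_comm (fderiv ℝ g x v) (N x),
      hS.inner_normal x hx, mul_zero, sub_zero]
  exact sub_eq_zero.1 (inner_self_eq_zero.1 hww)

/-- A surface contained in a sphere near one of its points covers a neighbourhood of that point in
the sphere. -/
theorem exists_open_inter_sphere_subset (hS : IsParamSurface Ω g N) (hp : p ∈ Ω) (hr : 0 < r)
    (h : ∀ᶠ y in 𝓝 p, ‖g y - o‖ = r) :
    ∃ O : Set E3, IsOpen O ∧ g p ∈ O ∧ O ∩ Metric.sphere o r ⊆ g '' Ω := by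
  have hn := hS.norm_normal p hp
  have hσ := sub_center_eq_smul_normal hS hp h
  set n := N p with hndef
  set σ := inner ℝ (g p - o) n with hσdef
  have hσ0 : σ ≠ 0 := by
    intro h0
    have := h.self_of_nhds
    rw [hσ, h0, zero_smul, norm_zero] at this
    exact hr.ne this
  obtain ⟨a, ha, han⟩ : ∃ a : E3, ‖a‖ = 1 ∧ inner ℝ a n = 0 := by
    have hv : (EuclideanSpace.single 0 1 : E2) ≠ 0 := by simp
    have hv' : fderiv ℝ g p (EuclideanSpace.single 0 1) ≠ 0 := fun h0 =>
      hv (hS.injective p hp (by rw [h0, map_zero]))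
    refine ⟨‖fderiv ℝ g p (EuclideanSpace.single 0 1)‖⁻¹ • fderiv ℝ g p (EuclideanSpace.single 0 1),
      norm_smul_inv_norm hv', ?_⟩
    rw [inner_smul_left, hS.inner_normal p hp, mul_zero]
  set b := cross a n
  have hb : ‖b‖ = 1 := norm_cross_of_orthonormal ha hn han
  have hab : inner ℝ a b = 0 := by rw [real_inner_comm]; exact inner_cross_left a n
  have hbn : inner ℝ b n = 0 := inner_cross_right a n
  have hside : ∀ᶠ y in 𝓝 p, 0 < inner ℝ (g y - o) n * σ := by
    have hc : ContinuousAt (fun y => inner ℝ (g y - o) n * σ) p :=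
      (((hS.contDiffAt hp).continuousAt.sub continuousAt_const).inner continuousAt_const).mul
        continuousAt_const
    exact hc.eventually_const_lt (mul_self_pos.2 hσ0)
  obtain ⟨Φ, hpΦ, hΦΩ, hΦ, -, -⟩ := exists_graph_coordinates hS ha hb hab hp han hbn (h.and hside)
  refine ⟨(fun x => (inner ℝ x a, inner ℝ x b)) ⁻¹' Φ.target ∩ {x | 0 < inner ℝ (x - o) n * σ},
    ?_, ⟨?_, ?_⟩, ?_⟩
  · refine (Φ.open_target.preimage ((continuous_id.inner continuous_const).prodMk
      (continuous_id.inner continuous_const))).inter (isOpen_lt continuous_const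
      (((continuous_id.sub continuous_const).inner continuous_const).mul continuous_const))
  · have := Φ.map_source hpΦ
    rwa [hΦ] at this
  · exact mul_self_pos.2 hσ0
  · rintro x ⟨⟨hx1, hx2⟩, hxs⟩
    have hy := hΦΩ (Φ.map_target hx1)
    have e := Φ.right_inv hx1
    rw [hΦ] at e
    set y := Φ.symm (inner ℝ x a, inner ℝ x b)
    refine ⟨y, hy.1, ?_⟩
    have ea : inner ℝ (g y) a = inner ℝ x a := congrArg Prod.fst e
    have eb : inner ℝ (g y) b = inner ℝ x b := congrArg Prod.snd e
    have x1 := eq_sum_inner_of_orthonormal ha hb hn hab han hbn (x - o)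
    have y1 := eq_sum_inner_of_orthonormal ha hb hn hab han hbn (g y - o)
    have xn : ‖x - o‖ = r := by rw [← dist_eq_norm]; exact hxs
    have key : ∀ z : E3, ‖z‖ ^ 2 = inner ℝ z a ^ 2 + inner ℝ z b ^ 2 + inner ℝ z n ^ 2 := by
      intro z
      rw [← real_inner_self_eq_norm_sq]
      nth_rewrite 1 [eq_sum_inner_of_orthonormal ha hb hn hab han hbn z]
      rw [inner_add_left, inner_add_left, inner_smul_left, inner_smul_left, inner_smul_left,
        real_inner_comm z a, real_inner_comm z b, real_inner_comm z n]
      simp only [conj_trivial]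
      ring
    have kx := key (x - o)
    have ky := key (g y - o)
    rw [xn] at kx
    rw [hy.2.1] at ky
    have ea' : inner ℝ (g y - o) a = inner ℝ (x - o) a := by rw [inner_sub_left, inner_sub_left, ea]
    have eb' : inner ℝ (g y - o) b = inner ℝ (x - o) b := by rw [inner_sub_left, inner_sub_left, eb]
    rw [ea', eb'] at ky
    -- `x` and `g y` have the same projection to the tangent plane and lie in the same hemisphere.
    have en : inner ℝ (g y - o) n = inner ℝ (x - o) n := by
      have hsq : inner ℝ (g y - o) n ^ 2 = inner ℝ (x - o) n ^ 2 := by linarith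
      rcases sq_eq_sq_iff_eq_or_eq_neg.1 hsq with h1 | h1
      · exact h1
      · have h2 : 0 < inner ℝ (g y - o) n * σ := hy.2.2
        have h3 : 0 < inner ℝ (x - o) n * σ := hx2
        rw [h1] at h2
        linarith
    rw [ea', eb', en, ← x1] at y1
    exact sub_left_injective y1

theorem eventually_norm_sub_eq_of_normal_add_smul (hS : IsParamSurface Ω g N) (hx : x ∈ Ω)
    {κ : ℝ} (hκ : κ ≠ 0) {a : E3} (h : ∀ᶠ y in 𝓝 x, N y + κ • g y = a) :
    ∀ᶠ y in 𝓝 x, ‖g y - κ⁻¹ • a‖ = |κ|⁻¹ := by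
  filter_upwards [h, hS.mem_nhds hx] with y hy hyΩ
  rw [← hy, smul_add, smul_smul, inv_mul_cancel₀ hκ, one_smul, sub_add_cancel_right, norm_neg,
    norm_smul, hS.norm_normal y hyΩ, mul_one, norm_inv, Real.norm_eq_abs]

theorem fderiv_eq_smul_fderiv_normal (hS : IsParamSurface Ω g N) (hx : x ∈ Ω) (hr : 0 < r)
    (h : ∀ᶠ y in 𝓝 x, ‖g y - o‖ = r) (v : E2) :
    fderiv ℝ g x v = inner ℝ (g x - o) (N x) • fderiv ℝ N x v := by
  set ρ : E2 → ℝ := fun y => inner ℝ (g y - o) (N y) with hρ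
  have hd : DifferentiableAt ℝ (fun y => g y - o) x :=
    ((hS.contDiffAt hx).differentiableAt (by simp)).sub_const o
  have hdN : DifferentiableAt ℝ N x := (hS.contDiffAt_normal hx).differentiableAt (by simp)
  have hdρ : DifferentiableAt ℝ ρ x := hd.inner ℝ hdN
  have e1 : (fun y => g y - o) =ᶠ[𝓝 x] fun y => ρ y • N y := by
    filter_upwards [h.eventually_nhds, hS.mem_nhds hx] with y hy hyΩ
    exact sub_center_eq_smul_normal hS hyΩ hy
  have hsq : ∀ᶠ y in 𝓝 x, ρ y ^ 2 = r ^ 2 := by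
    filter_upwards [e1, h, hS.mem_nhds hx] with y hy hyr hyΩ
    rw [← hyr, hy, norm_smul, hS.norm_normal y hyΩ, mul_one, Real.norm_eq_abs, sq_abs]
  have hρ0 : fderiv ℝ ρ x v = 0 := by
    have e2 : (fun y => ρ y ^ 2) =ᶠ[𝓝 x] fun _ => r ^ 2 := hsq
    have e3 := e2.fderiv_eq (𝕜 := ℝ)
    rw [fderiv_fun_pow 2 hdρ, fderiv_fun_const] at e3
    have e4 := congrArg (fun l : E2 →L[ℝ] ℝ => l v) e3
    have hne : ρ x ≠ 0 := by
      intro h0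
      have := hsq.self_of_nhds
      rw [h0] at this
      exact hr.ne' (by simpa using this.symm)
    simpa [hne] using e4
  have e5 := e1.fderiv_eq (𝕜 := ℝ)
  rw [fderiv_sub_const, fderiv_fun_smul hdρ hdN] at e5
  rw [e5, add_apply, ContinuousLinearMap.smulRight_apply, hρ0, zero_smul, add_zero]
  rfl

/-- The set of points near which the surface lies in a given sphere is closed. -/
theorem eventually_norm_sub_eq_of_frequently (hS : IsParamSurface Ω g N)
    (h₁ : IsPlanarField Ω g N V₁ m₁) (h₂ : IsPlanarField Ω g N V₂ m₂)
    (hD : ∀ W ⊆ Ω, IsOpen W → W.Nonempty → ∃ y ∈ W, cosAngle g V₁ V₂ y ^ 2 ≠ 1)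
    (hx : x ∈ Ω) (hr : 0 < r) (h : ∃ᶠ y in 𝓝 x, ∀ᶠ z in 𝓝 y, ‖g z - o‖ = r) :
    ∀ᶠ y in 𝓝 x, ‖g y - o‖ = r := by
  have hfreq := h.and_eventually (hS.mem_nhds hx)
  have hcg : ContinuousAt g x := (hS.contDiffAt hx).continuousAt
  have hcN : ContinuousAt N x := (hS.contDiffAt_normal hx).continuousAt
  have hcρ : ContinuousAt (fun y => inner ℝ (g y - o) (N y)) x :=
    (hcg.sub continuousAt_const).inner hcN
  have hnorm : ∀ y ∈ Ω, (∀ᶠ z in 𝓝 y, ‖g z - o‖ = r) → inner ℝ (g y - o) (N y) ^ 2 = r ^ 2 := by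
    intro y hy hyr
    have e := sub_center_eq_smul_normal hS hy hyr
    have e2 := hyr.self_of_nhds
    rw [e, norm_smul, hS.norm_normal y hy, mul_one, Real.norm_eq_abs] at e2
    rw [← e2, sq_abs]
  -- The equations that hold at the points `y` persist at their limit point `x`.
  have hlim : ∀ {F : Type} [TopologicalSpace F] [T2Space F] {A B : E2 → F}, ContinuousAt A x →
      ContinuousAt B x → (∃ᶠ y in 𝓝 x, A y = B y) → A x = B x := by
    intro F _ _ A B hA hB hAB
    by_contra hne
    exact hAB ((hA.ne_iff_eventually_ne hB).1 hne)
  have hρx : inner ℝ (g x - o) (N x) ^ 2 = r ^ 2 :=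
    hlim (hcρ.pow 2) continuousAt_const (hfreq.mono fun y hy => hnorm y hy.2 hy.1)
  have hinj : Function.Injective (fderiv ℝ N x) := by
    have hder : ∀ v, fderiv ℝ g x v = inner ℝ (g x - o) (N x) • fderiv ℝ N x v := fun v =>
      hlim (A := fun y => fderiv ℝ g y v)
        (B := fun y => inner ℝ (g y - o) (N y) • fderiv ℝ N y v)
        ((((hS.contDiffAt hx).fderiv_right (m := ∞) (by simp)).continuousAt).clm_apply
          continuousAt_const)
        (hcρ.smul ((((hS.contDiffAt_normal hx).fderiv_right (m := ∞)
          (by simp)).continuousAt).clm_apply continuousAt_const))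
        (hfreq.mono fun y hy => fderiv_eq_smul_fderiv_normal hS hy.2 hr hy.1 v)
    intro u v huv
    apply hS.injective x hx
    rw [hder, hder, huv]
  obtain ⟨κ, hκ, a, ha⟩ := exists_normal_add_smul_eq_const hS h₁ h₂ hD hx hinj
  -- Compare the sphere near `x` with the given one at a point `y` where both are available.
  obtain ⟨y, ⟨hyr, hyΩ⟩, hya⟩ := (hfreq.and_eventually ha.eventually_nhds).exists
  set ρ := inner ℝ (g y - o) (N y) with hρ
  have hdg := fderiv_eq_smul_fderiv_normal hS hyΩ hr hyr
  have hdN : ∀ v, fderiv ℝ N y v = -(κ • fderiv ℝ g y v) := by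
    intro v
    have e1 : N =ᶠ[𝓝 y] fun z => a - κ • g z := hya.mono fun z hz => eq_sub_of_add_eq hz
    have e2 := e1.fderiv_eq (𝕜 := ℝ)
    rw [fderiv_const_sub,
      fderiv_fun_const_smul ((hS.contDiffAt hyΩ).differentiableAt (by simp))] at e2
    rw [e2]; rfl
  have hρκ : ρ * κ = -1 := by
    have hv := hdg (V₁ y)
    rw [hdN] at hv
    have e := congrArg (fun z => inner ℝ z (fderiv ℝ g y (V₁ y))) hv
    simp only [inner_smul_left, inner_neg_left, real_inner_self_eq_norm_sq, h₁.norm_dir y hyΩ,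
      conj_trivial] at e
    linarith
  have ho : κ⁻¹ • a = o := by
    have e1 := sub_center_eq_smul_normal hS hyΩ hyr
    have e2 : a = κ • o := by
      rw [← hya.self_of_nhds, ← sub_add_cancel (g y) o, e1, smul_add, smul_smul, ← hρ, mul_comm κ,
        hρκ]
      module
    rw [e2, smul_smul, inv_mul_cancel₀ hκ, one_smul]
  have hr' : |κ|⁻¹ = r := by
    have e1 : (ρ * κ) ^ 2 = 1 := by rw [hρκ]; norm_num
    rw [mul_pow, hnorm y hyΩ hyr, ← mul_pow, ← sq_abs, abs_mul, abs_of_pos hr] at e1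
    have e2 : r * |κ| = 1 := by
      have : 0 ≤ r * |κ| := by positivity
      nlinarith
    exact (eq_inv_of_mul_eq_one_left e2).symm
  have := eventually_norm_sub_eq_of_normal_add_smul hS hx hκ ha
  rwa [ho, hr'] at this

end Sphere

/-! ### From the abstract surface to a chart, and the global alternative -/

section Transfer

variable {M : Type*} [TopologicalSpace M] [ChartedSpace E2 M] [IsManifold (𝓡 2) ∞ M]
  {f : M → E3} {p₀ : M}

theorem mdifferentiable_chartAt (p₀ : M) :
    (chartAt E2 p₀).MDifferentiable (𝓡 2) (𝓡 2) :=
  have : IsManifold (𝓡 2) 1 M := IsManifold.of_le (n := ∞) (by simp)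
  mdifferentiable_chart p₀

/-- A smooth vector field on an open set of a surface, read in a chart. -/
theorem exists_field_in_chart (p₀ : M) {U : Set M} (hU : IsOpen U)
    {X : (q : M) → TangentSpace (𝓡 2) q}
    (hX : ContMDiffOn (𝓡 2) (𝓡 2).tangent ∞ (fun q => (⟨q, X q⟩ : TangentBundle (𝓡 2) M)) U) :
    ∃ V : E2 → E2,
      ContDiffOn ℝ ∞ V ((chartAt E2 p₀).target ∩ (chartAt E2 p₀).symm ⁻¹' U) ∧
      ∀ x ∈ (chartAt E2 p₀).target,
        mfderiv (𝓡 2) (𝓡 2) (chartAt E2 p₀).symm x (V x) = X ((chartAt E2 p₀).symm x) := by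
  have hM1 : IsManifold (𝓡 2) 1 M := IsManifold.of_le (n := ∞) (by simp)
  set φ := chartAt E2 p₀
  set e := trivializationAt E2 (TangentSpace (𝓡 2) : M → Type _) p₀
  have hbase : e.baseSet = φ.source := TangentBundle.trivializationAt_baseSet p₀
  refine ⟨fun x => (e ⟨φ.symm x, X (φ.symm x)⟩).2, ?_, ?_⟩
  · have h1 : ContMDiffOn (𝓡 2) 𝓘(ℝ, E2) ∞ (fun q => (e ⟨q, X q⟩).2) (φ.source ∩ U) :=
      (e.contMDiffOn_section_iff (φ.open_source.inter hU)
        (by rw [hbase]; exact inter_subset_left)).1 (hX.mono inter_subset_right)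
    have h2 : ContMDiffOn (𝓡 2) (𝓡 2) ∞ φ.symm φ.target := contMDiffOn_chart_symm
    have h3 := h1.comp (h2.mono inter_subset_left) fun x hx => ⟨φ.map_target hx.1, hx.2⟩
    exact h3.contDiffOn
  · intro x hx
    have hs : φ.symm x ∈ φ.source := φ.map_target hx
    have h4 : (e ⟨φ.symm x, X (φ.symm x)⟩).2 =
        mfderiv (𝓡 2) (𝓡 2) φ (φ.symm x) (X (φ.symm x)) := by
      have := DFunLike.congr_fun (TangentBundle.continuousLinearMapAt_trivializationAt
        (𝕜 := ℝ) (I := 𝓡 2) hs) (X (φ.symm x))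
      rw [Bundle.Trivialization.continuousLinearMapAt_apply,
        Bundle.Trivialization.coe_linearMapAt_of_mem _ (by rw [hbase]; exact hs)] at this
      exact this
    have h5 := DFunLike.congr_fun ((mdifferentiable_chartAt p₀).symm_comp_deriv hs) (X (φ.symm x))
    have h6 : φ (φ.symm x) = x := φ.right_inv hx
    change mfderiv (𝓡 2) (𝓡 2) φ.symm x (e ⟨φ.symm x, X (φ.symm x)⟩).2 = _
    rw [h4]
    have h7 : mfderiv (𝓡 2) (𝓡 2) φ.symm (φ (φ.symm x))
        (mfderiv (𝓡 2) (𝓡 2) φ (φ.symm x) (X (φ.symm x))) = X (φ.symm x) := h5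
    rw [h6] at h7
    exact h7

theorem contDiffOn_comp_chart_symm (hf : IsSurfaceImmersion f) (p₀ : M) :
    ContDiffOn ℝ ∞ (f ∘ (chartAt E2 p₀).symm) (chartAt E2 p₀).target := by
  have h2 : ContMDiffOn (𝓡 2) (𝓡 2) ∞ (chartAt E2 p₀).symm (chartAt E2 p₀).target :=
    contMDiffOn_chart_symm
  exact (hf.1.comp_contMDiffOn h2).contDiffOn

theorem fderiv_comp_chart_symm (hf : IsSurfaceImmersion f) {x : E2}
    (hx : x ∈ (chartAt E2 p₀).target) (v : E2) :
    fderiv ℝ (f ∘ (chartAt E2 p₀).symm) x v =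
      mfderiv (𝓡 2) 𝓘(ℝ, E3) f ((chartAt E2 p₀).symm x)
        (mfderiv (𝓡 2) (𝓡 2) (chartAt E2 p₀).symm x v) := by
  have h := mfderiv_comp x (hf.1.mdifferentiableAt (by simp) :
    MDifferentiableAt (𝓡 2) 𝓘(ℝ, E3) f ((chartAt E2 p₀).symm x))
    ((mdifferentiable_chartAt p₀).mdifferentiableAt_symm hx)
  rw [← mfderiv_eq_fderiv]
  exact DFunLike.congr_fun h v

theorem injective_fderiv_comp_chart_symm (hf : IsSurfaceImmersion f) {x : E2}
    (hx : x ∈ (chartAt E2 p₀).target) :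
    Function.Injective (fderiv ℝ (f ∘ (chartAt E2 p₀).symm) x) := by
  intro u v huv
  rw [fderiv_comp_chart_symm hf hx, fderiv_comp_chart_symm hf hx] at huv
  exact (mdifferentiable_chartAt p₀).symm.mfderiv_injective hx (hf.2 _ huv)

theorem mem_normalLine_of_inner_eq_zero (hf : IsSurfaceImmersion f) {x : E2}
    (hx : x ∈ (chartAt E2 p₀).target) {w : E3}
    (hw : ∀ v, inner ℝ (fderiv ℝ (f ∘ (chartAt E2 p₀).symm) x v) w = 0) :
    w ∈ normalLine f ((chartAt E2 p₀).symm x) := by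
  rw [normalLine, Submodule.mem_orthogonal]
  rintro _ ⟨u, rfl⟩
  obtain ⟨v, hv⟩ := (mdifferentiable_chartAt p₀).symm.mfderiv_surjective hx u
  rw [← hv]
  exact (congrArg (fun z => inner ℝ z w) (fderiv_comp_chart_symm hf hx v)).symm.trans (hw v)

/-- A surface, read in a chart, with the unit normal field given by the cross product. -/
theorem exists_isParamSurface (hf : IsSurfaceImmersion f) (p₀ : M) :
    ∃ N, IsParamSurface (chartAt E2 p₀).target (f ∘ (chartAt E2 p₀).symm) N := by
  set φ := chartAt E2 p₀
  set g := f ∘ φ.symm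
  have hg : ContDiffOn ℝ ∞ g φ.target := contDiffOn_comp_chart_symm hf p₀
  have hdg : ∀ v, ContDiffOn ℝ ∞ (fun x => fderiv ℝ g x v) φ.target := fun v =>
    (hg.fderiv_of_isOpen φ.open_target (by simp)).clm_apply contDiffOn_const
  have hlin : LinearIndependent ℝ
      ![(EuclideanSpace.single 0 1 : E2), EuclideanSpace.single 1 1] := by
    rw [LinearIndependent.pair_iff]
    intro s t h
    exact ⟨by simpa using congrArg (fun z : E2 => z 0) h,
      by simpa using congrArg (fun z : E2 => z 1) h⟩
  set n : E2 → E3 := fun x => cross (fderiv ℝ g x (EuclideanSpace.single 0 1))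
    (fderiv ℝ g x (EuclideanSpace.single 1 1)) with hn
  have hns : ContDiffOn ℝ ∞ n φ.target := (hdg _).cross (hdg _)
  have hn0 : ∀ x ∈ φ.target, n x ≠ 0 := fun x hx => by
    apply cross_ne_zero
    rw [LinearIndependent.pair_iff] at hlin ⊢
    intro s t h
    rw [← map_smul, ← map_smul, ← map_add] at h
    exact hlin s t (injective_fderiv_comp_chart_symm hf hx (h.trans (map_zero _).symm))
  refine ⟨fun x => ‖n x‖⁻¹ • n x, φ.open_target, hg,
    fun x hx => injective_fderiv_comp_chart_symm hf hx,
    ((hns.norm ℝ hn0).inv fun x hx => norm_ne_zero_iff.2 (hn0 x hx)).smul hns,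
    fun x hx => norm_smul_inv_norm (hn0 x hx), fun x hx v => ?_⟩
  have hv : v = v 0 • (EuclideanSpace.single 0 1 : E2) + v 1 • EuclideanSpace.single 1 1 := by
    ext i
    fin_cases i <;> simp
  rw [hv, map_add, map_smul, map_smul, inner_smul_right, inner_add_left, inner_smul_left,
    inner_smul_left, real_inner_comm (n x), real_inner_comm (n x), hn, inner_cross_left,
    inner_cross_right]
  simp

/-- Along a curve with unit tangent `e` and surface normal `n` that lies, with its surface normal, in
a plane, the conormal has derivative zero. -/
theorem deriv_conormal_eq_zero {P : AffineSubspace ℝ E3} (hP : Module.finrank ℝ P.direction = 2)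
    {I : Set ℝ} (hI : IsOpen I) {γ e m n : ℝ → E3} (hγ : ∀ t ∈ I, HasDerivAt γ (e t) t)
    (he : ∀ t ∈ I, ‖e t‖ = 1) (hm : ∀ t ∈ I, ‖m t‖ = 1) (hn : ∀ t ∈ I, ‖n t‖ = 1)
    (hem : ∀ t ∈ I, inner ℝ (e t) (m t) = 0) (hen : ∀ t ∈ I, inner ℝ (e t) (n t) = 0)
    (hmn : ∀ t ∈ I, inner ℝ (m t) (n t) = 0) (hγP : ∀ t ∈ I, γ t ∈ P)
    (hnP : ∀ t ∈ I, n t ∈ P.direction) {t : ℝ} (ht : t ∈ I) {d : E3} (hd : HasDerivAt m d t) :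
    d = 0 := by
  obtain ⟨w, hw, hw0⟩ : ∃ w ∈ P.directionᗮ, w ≠ 0 := by
    apply Submodule.exists_mem_ne_zero_of_ne_bot
    intro h
    have := Submodule.finrank_add_finrank_orthogonal P.direction
    rw [hP, h] at this
    simp at this
  have hnw : ∀ s ∈ I, inner ℝ (n s) w = 0 := fun s hs =>
    (Submodule.mem_orthogonal _ _).1 hw _ (hnP s hs)
  have hew : ∀ s ∈ I, inner ℝ (e s) w = 0 := by
    intro s hs
    have h1 : HasDerivAt (fun u => inner ℝ (γ u - γ s) w) (inner ℝ (e s) w) s := by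
      have := ((hγ s hs).sub_const (γ s)).inner ℝ (hasDerivAt_const s w)
      simpa using this
    have h2 : (fun u => inner ℝ (γ u - γ s) w) =ᶠ[𝓝 s] fun _ => (0 : ℝ) :=
      Filter.eventually_of_mem (hI.mem_nhds hs) fun u hu =>
        (Submodule.mem_orthogonal _ _).1 hw _
          (AffineSubspace.vsub_mem_direction (hγP u hu) (hγP s hs))
    exact h1.unique ((hasDerivAt_const s (0 : ℝ)).congr_of_eventuallyEq h2)
  -- The normal `w` of the plane is a multiple of the conormal.
  have hwm : ∀ s ∈ I, w = inner ℝ w (m s) • m s := by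
    intro s hs
    have := eq_sum_inner_of_orthonormal (he s hs) (hm s hs) (hn s hs) (hem s hs) (hen s hs)
      (hmn s hs) w
    rwa [real_inner_comm (e s), hew s hs, real_inner_comm (n s), hnw s hs, zero_smul, zero_smul,
      zero_add, add_zero] at this
  have hperp : ∀ z : E3, inner ℝ z w = 0 → inner ℝ d z = 0 := by
    intro z hz
    have h1 : HasDerivAt (fun u => inner ℝ (m u) z) (inner ℝ d z) t := by
      have := hd.inner ℝ (hasDerivAt_const t z)
      simpa using this
    have h2 : (fun u => inner ℝ (m u) z) =ᶠ[𝓝 t] fun _ => (0 : ℝ) :=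
      Filter.eventually_of_mem (hI.mem_nhds ht) fun u hu => by
        have h3 := hz
        rw [hwm u hu, inner_smul_right, mul_eq_zero] at h3
        rcases h3 with h3 | h3
        · exact absurd (by rw [hwm u hu, h3, zero_smul]) hw0
        · show inner ℝ (m u) z = 0
          rw [real_inner_comm]; exact h3
    exact h1.unique ((hasDerivAt_const t (0 : ℝ)).congr_of_eventuallyEq h2)
  have hdm : inner ℝ d (m t) = 0 := by
    have h1 := hd.inner ℝ hd
    have h2 : (fun u => inner ℝ (m u) (m u)) =ᶠ[𝓝 t] fun _ => (1 : ℝ) :=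
      Filter.eventually_of_mem (hI.mem_nhds ht) fun u hu => by
        show inner ℝ (m u) (m u) = 1
        rw [real_inner_self_eq_norm_sq, hm u hu, one_pow]
    have h3 := h1.unique ((hasDerivAt_const t (1 : ℝ)).congr_of_eventuallyEq h2)
    rw [real_inner_comm d] at h3
    linarith
  have := eq_sum_inner_of_orthonormal (he t ht) (hm t ht) (hn t ht) (hem t ht) (hen t ht)
      (hmn t ht) d
  rwa [hperp _ (hew t ht), hdm, hperp _ (hnw t ht), zero_smul, zero_smul, zero_smul, zero_add,
    add_zero] at this

/-- A planar geodesic foliation, read in a chart. -/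
theorem exists_isPlanarField (hf : IsSurfaceImmersion f)
    {L : (p : M) → Submodule ℝ (TangentSpace (𝓡 2) p)} (h : IsPlanarGeodesicFoliation f L) (p₀ : M)
    {N : E2 → E3}
    (hS : IsParamSurface (chartAt E2 p₀).target (f ∘ (chartAt E2 p₀).symm) N) :
    ∃ Ω ⊆ (chartAt E2 p₀).target, IsOpen Ω ∧ chartAt E2 p₀ p₀ ∈ Ω ∧ ∃ V m,
      IsPlanarField Ω (f ∘ (chartAt E2 p₀).symm) N V m ∧
      ∀ x ∈ Ω, L ((chartAt E2 p₀).symm x) =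
        Submodule.span ℝ {mfderiv (𝓡 2) (𝓡 2) (chartAt E2 p₀).symm x (V x)} := by
  obtain ⟨U, hU, hpU, X, hX, hXL⟩ := h.foliation p₀
  obtain ⟨V₀, hV₀, hV₀X⟩ := exists_field_in_chart p₀ hU hX
  set φ := chartAt E2 p₀
  set g := f ∘ φ.symm
  have hΩ : IsOpen (φ.target ∩ φ.symm ⁻¹' U) := φ.isOpen_inter_preimage_symm hU
  set Ω := φ.target ∩ φ.symm ⁻¹' U with hΩdef
  have hΩt : Ω ⊆ φ.target := inter_subset_left
  have hSΩ := hS.mono hΩ hΩt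
  have hp : φ p₀ ∈ Ω := by
    refine ⟨φ.map_source (mem_chart_source _ _), ?_⟩
    rw [mem_preimage, φ.left_inv (mem_chart_source _ _)]
    exact hpU
  have hne : ∀ x ∈ Ω, fderiv ℝ g x (V₀ x) ≠ 0 := by
    intro x hx h0
    have : V₀ x = 0 := hSΩ.injective x hx (by rw [h0, map_zero])
    apply (hXL _ hx.2).1
    rw [← hV₀X x hx.1, this]
    exact map_zero (mfderiv (𝓡 2) (𝓡 2) φ.symm x)
  have hdg : ContDiffOn ℝ ∞ (fderiv ℝ g) Ω := hSΩ.smooth.fderiv_of_isOpen hΩ (by simp)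
  have hs₀ : ContDiffOn ℝ ∞ (fun x => ‖fderiv ℝ g x (V₀ x)‖⁻¹) Ω :=
    ((hdg.clm_apply hV₀).norm ℝ hne).inv fun x hx => norm_ne_zero_iff.2 (hne x hx)
  set V : E2 → E2 := fun x => ‖fderiv ℝ g x (V₀ x)‖⁻¹ • V₀ x with hVdef
  have hV : ContDiffOn ℝ ∞ V Ω := hs₀.smul hV₀
  have hL : ∀ x ∈ Ω, L (φ.symm x) = Submodule.span ℝ {mfderiv (𝓡 2) (𝓡 2) φ.symm x (V x)} := by
    intro x hx
    rw [(hXL _ hx.2).2]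
    have : mfderiv (𝓡 2) (𝓡 2) φ.symm x (V x) = ‖fderiv ℝ g x (V₀ x)‖⁻¹ • X (φ.symm x) := by
      rw [← hV₀X x hx.1]
      exact map_smul (mfderiv (𝓡 2) (𝓡 2) φ.symm x) _ _
    rw [this]
    exact (Submodule.span_singleton_smul_eq
      (inv_ne_zero (norm_ne_zero_iff.2 (hne x hx))).isUnit _).symm
  have hnorm : ∀ x ∈ Ω, ‖fderiv ℝ g x (V x)‖ = 1 := fun x hx => by
    rw [hVdef, map_smul]
    exact norm_smul_inv_norm (hne x hx)
  set m : E2 → E3 := fun x => cross (N x) (fderiv ℝ g x (V x)) with hmdef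
  have hm : ContDiffOn ℝ ∞ m Ω := hSΩ.smooth_normal.cross (hdg.clm_apply hV)
  have hm1 : ∀ x ∈ Ω, ‖m x‖ = 1 := fun x hx =>
    norm_cross_of_orthonormal (hSΩ.norm_normal x hx) (hnorm x hx)
      (by rw [real_inner_comm]; exact hSΩ.inner_normal x hx _)
  have hmN : ∀ x, inner ℝ (m x) (N x) = 0 := fun x => inner_cross_left _ _
  have hem : ∀ x, inner ℝ (fderiv ℝ g x (V x)) (m x) = 0 := fun x => by
    rw [real_inner_comm]; exact inner_cross_right _ _
  refine ⟨Ω, hΩt, hΩ, hp, V, m, ⟨hV, hm, hnorm, hm1, fun x _ => hmN x, fun x _ => hem x,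
    fun x hx => ?_⟩, hL⟩
  obtain ⟨r, hr, ε, hε, H⟩ := exists_integralCurves hΩ hV hx
  obtain ⟨c, rfl, hc⟩ := H x (Metric.mem_ball_self hr)
  have hcs : ContDiffOn ℝ ∞ c (Ioo (-ε) ε) := contDiffOn_of_integralCurve hV hc
  have h0 : (0 : ℝ) ∈ Ioo (-ε) ε := ⟨by linarith, hε⟩
  have hγ : ∀ t ∈ Ioo (-ε) ε, HasDerivAt (g ∘ c) (fderiv ℝ g (c t) (V (c t))) t := fun t ht =>
    ((hSΩ.contDiffAt (hc t ht).1).differentiableAt (by simp)).hasFDerivAt.comp_hasDerivAt t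
      (hc t ht).2
  have hleaf : IsUnitSpeedLeafCurve f L (Ioo (-ε) ε) (φ.symm ∘ c) := by
    refine ⟨isOpen_Ioo, ordConnected_Ioo, ?_, fun t ht => ⟨?_, ?_⟩⟩
    · have h2 : ContMDiffOn (𝓡 2) (𝓡 2) ∞ φ.symm φ.target := contMDiffOn_chart_symm
      exact h2.comp hcs.contMDiffOn fun t ht => hΩt (hc t ht).1
    · have hcd := (hc t ht).2
      have e1 := mfderiv_comp (I := 𝓘(ℝ, ℝ)) (I' := 𝓡 2) (I'' := 𝓡 2) t
        ((mdifferentiable_chartAt p₀).mdifferentiableAt_symm (hΩt (hc t ht).1))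
        hcd.differentiableAt.mdifferentiableAt
      have e2 : mfderiv 𝓘(ℝ, ℝ) (𝓡 2) c t (1 : ℝ) = V (c t) := by
        rw [mfderiv_eq_fderiv]
        exact hcd.deriv
      have e3 : mfderiv 𝓘(ℝ, ℝ) (𝓡 2) (φ.symm ∘ c) t (1 : ℝ) =
          mfderiv (𝓡 2) (𝓡 2) φ.symm (c t) (mfderiv 𝓘(ℝ, ℝ) (𝓡 2) c t (1 : ℝ)) :=
        DFunLike.congr_fun e1 (1 : ℝ)
      rw [e3, e2]
      change _ ∈ L (φ.symm (c t))
      rw [hL _ (hc t ht).1]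
      exact Submodule.mem_span_singleton_self _
    · change ‖deriv (g ∘ c) t‖ = 1
      rw [(hγ t ht).deriv]
      exact hnorm _ (hc t ht).1
  obtain ⟨P, hP, hPc⟩ := h.planar _ _ hleaf
  refine deriv_conormal_eq_zero hP isOpen_Ioo (m := m ∘ c) (n := N ∘ c) hγ
    (fun t ht => hnorm _ (hc t ht).1) (fun t ht => hm1 _ (hc t ht).1)
    (fun t ht => hSΩ.norm_normal _ (hc t ht).1) (fun t ht => hem _)
    (fun t ht => hSΩ.inner_normal _ (hc t ht).1 _) (fun t ht => hmN _)
    (fun t ht => (hPc t ht).1) (fun t ht => (hPc t ht).2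
      (mem_normalLine_of_inner_eq_zero hf (hΩt (hc t ht).1) (hSΩ.inner_normal _ (hc t ht).1))) h0
    (((hm.contDiffAt (hΩ.mem_nhds hx)).differentiableAt (by simp)).hasFDerivAt.comp_hasDerivAt
      (0 : ℝ) (hc 0 h0).2)

/-- Both foliations, read in a common chart. -/
theorem exists_planarFields (hf : IsSurfaceImmersion f)
    {L₁ L₂ : (p : M) → Submodule ℝ (TangentSpace (𝓡 2) p)}
    (h₁ : IsPlanarGeodesicFoliation f L₁) (h₂ : IsPlanarGeodesicFoliation f L₂)
    (hdistinct : ∀ U : Set M, IsOpen U → U.Nonempty → ∃ p ∈ U, L₁ p ≠ L₂ p) (p₀ : M) :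
    ∃ Ω ⊆ (chartAt E2 p₀).target, chartAt E2 p₀ p₀ ∈ Ω ∧ ∃ N V₁ m₁ V₂ m₂,
      IsParamSurface Ω (f ∘ (chartAt E2 p₀).symm) N ∧
      IsPlanarField Ω (f ∘ (chartAt E2 p₀).symm) N V₁ m₁ ∧
      IsPlanarField Ω (f ∘ (chartAt E2 p₀).symm) N V₂ m₂ ∧
      ∀ W ⊆ Ω, IsOpen W → W.Nonempty →
        ∃ y ∈ W, cosAngle (f ∘ (chartAt E2 p₀).symm) V₁ V₂ y ^ 2 ≠ 1 := by
  obtain ⟨N, hS⟩ := exists_isParamSurface hf p₀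
  obtain ⟨Ω₁, hΩ₁t, hΩ₁, hp₁, V₁, m₁, hF₁, hL₁⟩ := exists_isPlanarField hf h₁ p₀ hS
  obtain ⟨Ω₂, hΩ₂t, hΩ₂, hp₂, V₂, m₂, hF₂, hL₂⟩ := exists_isPlanarField hf h₂ p₀ hS
  have hΩt : Ω₁ ∩ Ω₂ ⊆ (chartAt E2 p₀).target := inter_subset_left.trans hΩ₁t
  refine ⟨Ω₁ ∩ Ω₂, hΩt, ⟨hp₁, hp₂⟩, N, V₁, m₁, V₂, m₂, hS.mono (hΩ₁.inter hΩ₂) hΩt,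
    hF₁.mono inter_subset_left, hF₂.mono inter_subset_right, fun W hW hWo hWne => ?_⟩
  set φ := chartAt E2 p₀
  have hWt : W ⊆ φ.target := hW.trans hΩt
  obtain ⟨_, ⟨y, hy, rfl⟩, hne⟩ := hdistinct (φ.symm '' W)
    (φ.symm.isOpen_image_of_subset_source hWo hWt) (hWne.image _)
  refine ⟨y, hy, fun hc => hne ?_⟩
  have hy₁ := (hW hy).1
  have hy₂ := (hW hy).2
  have n₁ := hF₁.norm_dir y hy₁
  have n₂ := hF₂.norm_dir y hy₂
  rw [hL₁ y hy₁, hL₂ y hy₂]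
  have hVV : V₁ y = V₂ y ∨ V₁ y = -V₂ y := by
    rcases mul_self_eq_one_iff.1 ((sq _).symm.trans hc) with h | h
    · left
      exact hS.injective y (hWt hy) ((inner_eq_one_iff_of_norm_eq_one n₁ n₂).1 h)
    · right
      apply hS.injective y (hWt hy)
      rw [map_neg]
      apply (inner_eq_one_iff_of_norm_eq_one (𝕜 := ℝ) n₁ (by rw [norm_neg, n₂])).1
      rw [inner_neg_right]
      change -cosAngle _ V₁ V₂ y = 1
      rw [h, neg_neg]
  rcases hVV with h | h
  · rw [h]
  · have e : mfderiv (𝓡 2) (𝓡 2) φ.symm y (V₁ y) = -mfderiv (𝓡 2) (𝓡 2) φ.symm y (V₂ y) := by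
      rw [h]
      exact map_neg (mfderiv (𝓡 2) (𝓡 2) φ.symm y) _
    rw [e]
    rw [← Set.neg_singleton, Submodule.span_neg]

end Transfer

theorem theorem2p2 {M : Type*} [TopologicalSpace M] [T2Space M] [ConnectedSpace M]
    [ChartedSpace E2 M] [IsManifold (𝓡 2) ∞ M]
    (f : M → E3) (hf : IsSurfaceImmersion f)
    (L₁ L₂ : (p : M) → Submodule ℝ (TangentSpace (𝓡 2) p))
    (h₁ : IsPlanarGeodesicFoliation f L₁) (h₂ : IsPlanarGeodesicFoliation f L₂)
    (hdistinct : ∀ U : Set M, IsOpen U → U.Nonempty → ∃ p ∈ U, L₁ p ≠ L₂ p) :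
    (∃ (o : E3) (r : ℝ), 0 < r ∧ IsOpenSubsetOf (Set.range f) (Metric.sphere o r)) ∨
    (∀ p : M, ∃ U : Set M, IsOpen U ∧ p ∈ U ∧ Set.InjOn f U ∧
      ∃ C : Set E3, IsCylinderOverPlaneCurve C ∧ IsOpenSubsetOf (f '' U) C) := by
  have hchart := exists_planarFields hf h₁ h₂ hdistinct
  have hnhds : ∀ (p₀ : M) {x : E2}, x ∈ (chartAt E2 p₀).target →
      Filter.map (chartAt E2 p₀).symm (𝓝 x) = 𝓝 ((chartAt E2 p₀).symm x) := fun p₀ x hx =>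
    (chartAt E2 p₀).symm.map_nhds_eq hx
  by_cases hsph : ∃ (o : E3) (r : ℝ), 0 < r ∧ ∃ p : M, ∀ᶠ q in 𝓝 p, ‖f q - o‖ = r
  · left
    obtain ⟨o, r, hr, p₁, hp₁⟩ := hsph
    have hclopen : IsClopen {p : M | ∀ᶠ q in 𝓝 p, ‖f q - o‖ = r} := by
      refine ⟨?_, isOpen_setOfPred_eventually_nhds⟩
      rw [← closure_subset_iff_isClosed]
      intro p hp
      rw [mem_closure_iff_frequently] at hp
      obtain ⟨Ω, hΩt, hpΩ, N, V₁, m₁, V₂, m₂, hS, hF₁, hF₂, hD⟩ := hchart p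
      have hleft : (chartAt E2 p).symm (chartAt E2 p p) = p :=
        (chartAt E2 p).left_inv (mem_chart_source _ _)
      have hn := hnhds p (hΩt hpΩ)
      rw [hleft] at hn
      rw [← hn, Filter.frequently_map] at hp
      have := eventually_norm_sub_eq_of_frequently hS hF₁ hF₂ hD hpΩ hr (o := o) (by
        refine (hp.and_eventually (hS.mem_nhds hpΩ)).mono fun y hy => ?_
        have h2 : ∀ᶠ q in 𝓝 ((chartAt E2 p).symm y), ‖f q - o‖ = r := hy.1
        rwa [← hnhds p (hΩt hy.2), Filter.eventually_map] at h2)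
      show ∀ᶠ q in 𝓝 p, ‖f q - o‖ = r
      rw [← hn, Filter.eventually_map]
      exact this
    have hall : ∀ p : M, ∀ᶠ q in 𝓝 p, ‖f q - o‖ = r := fun p => by
      have : p ∈ {p : M | ∀ᶠ q in 𝓝 p, ‖f q - o‖ = r} := by
        rw [hclopen.eq_univ ⟨p₁, hp₁⟩]; trivial
      exact this
    have hcover : ∀ p : M, ∃ O : Set E3, IsOpen O ∧ f p ∈ O ∧
        O ∩ Metric.sphere o r ⊆ Set.range f := by
      intro p
      obtain ⟨Ω, hΩt, hpΩ, N, V₁, m₁, V₂, m₂, hS, hF₁, hF₂, hD⟩ := hchart p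
      have hleft : (chartAt E2 p).symm (chartAt E2 p p) = p :=
        (chartAt E2 p).left_inv (mem_chart_source _ _)
      have h2 := hall p
      rw [← hleft, ← hnhds p (hΩt hpΩ), Filter.eventually_map] at h2
      obtain ⟨O, hO, hpO, hsub⟩ := exists_open_inter_sphere_subset hS hpΩ hr h2
      refine ⟨O, hO, by rwa [Function.comp_apply, hleft] at hpO, hsub.trans ?_⟩
      rintro _ ⟨y, -, rfl⟩
      exact ⟨_, rfl⟩
    choose O hO hpO hsub using hcover
    refine ⟨o, r, hr, ⋃ p, O p, isOpen_iUnion hO, Subset.antisymm ?_ ?_⟩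
    · rintro _ ⟨p, rfl⟩
      exact ⟨mem_iUnion.2 ⟨p, hpO p⟩, mem_sphere_iff_norm.2 (hall p).self_of_nhds⟩
    · rintro x ⟨hx, hxs⟩
      obtain ⟨p, hp⟩ := mem_iUnion.1 hx
      exact hsub p ⟨hp, hxs⟩
  · right
    intro p
    obtain ⟨Ω, hΩt, hpΩ, N, V₁, m₁, V₂, m₂, hS, hF₁, hF₂, hD⟩ := hchart p
    have hflat : ∀ y ∈ Ω, ¬ Function.Injective (fderiv ℝ N y) := by
      intro y hy hinj
      obtain ⟨κ, hκ, a, ha⟩ := exists_normal_add_smul_eq_const hS hF₁ hF₂ hD hy hinj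
      refine hsph ⟨κ⁻¹ • a, |κ|⁻¹, by positivity, (chartAt E2 p).symm y, ?_⟩
      rw [← hnhds p (hΩt hy), Filter.eventually_map]
      exact eventually_norm_sub_eq_of_normal_add_smul hS hy hκ ha
    obtain ⟨e, he, hev⟩ := exists_const_tangent hS hF₁ hF₂ hD hflat hpΩ
    obtain ⟨U, hUΩ, hU, hpU, hinj, C, hC, hUC⟩ := exists_cylinder hS hpΩ he hev
    refine ⟨(chartAt E2 p).symm '' U,
      (chartAt E2 p).symm.isOpen_image_of_subset_source hU (hUΩ.trans hΩt),
      ⟨_, hpU, (chartAt E2 p).left_inv (mem_chart_source _ _)⟩, ?_, C, hC, ?_⟩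
    · rintro _ ⟨x, hx, rfl⟩ _ ⟨y, hy, rfl⟩ hxy
      exact congrArg _ (hinj hx hy hxy)
    · rwa [← image_comp]
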